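/- Let $G$ be a finite group. The Burnside category $\mathcal{A}^G$ has as objects the finite $G$-sets; $\mathcal{A}^G(X,Y)$ is the group completion of the commutative monoid, under disjoint union, of isomorphism classes of spans $X\leftarrow A\to Y$ of finite $G$-sets, and composition is given by pullback. A $G$-Mackey functor is an additive functor $\mathcal{A}^G\to\mathrm{Ab}$; morphisms are natural transformations, and $\mathrm{Mack}_G$ denotes the resulting category. The box product $\underline{M}\boxtimes\underline{L}$ of $G$-Mackey functors is the left Kan extension of $(X,Y)\mapsto \underline{M}(X)\otimes_{\mathbb{Z}}\underline{L}(Y)$ along the cartesian product functor $\times\colon\mathcal{A}^G\times\mathcal{A}^G\to\mathcal{A}^G$. A $G$-Mackey functor $\underline{M}$ is called flat if the functor $-\boxtimes\underline{M}\colon\mathrm{Mack}_G\to\mathrm{Mack}_G$ is exact. Let $N$ be a normal subgroup of $G$ and $Q=G/N$. Let $\underline{A}=\mathcal{A}^G(*,-)$ be the Burnside Mackey functor, let $\underline{E\mathcal{F}}_N\subseteq\underline{A}$ be the sub-Mackey functor generated by the groups $\underline{A}(G/H)$ for all subgroups $H\leq G$ that do not contain $N$, and put $\underline{\widetilde{E}\mathcal{F}}_N=\underline{A}/\underline{E\mathcal{F}}_N$.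 Let $q_\ast\colon\mathrm{Mack}_G\to\mathrm{Mack}_Q$ be precomposition with the functor $q^\ast\colon\mathcal{A}^Q\to\mathcal{A}^G$ that regards finite $Q$-sets, and spans of them, as finite $G$-sets, and spans of them, through the quotient map $G\to Q$. The $N$-geometric fixed points functor is $$\Phi^N=q_\ast\circ\bigl(\underline{\widetilde{E}\mathcal{F}}_N\boxtimes(-)\bigr)\colon\mathrm{Mack}_G\to\mathrm{Mack}_Q.$$ Theorem. If $\underline{M}$ is a flat $G$-Mackey functor, then $\Phi^N\underline{M}$ is a flat $Q$-Mackey functor. -/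

import Mathlib

open CategoryTheory CategoryTheory.Limits
open scoped TensorProduct

universe u

namespace EquivariantAlgebra

/-! ### Finite `G`-sets and spans -/

/-- A finite `G`-set.  Maps of finite `G`-sets are Mathlib's equivariant maps `X →[G] Y`. -/
structure FinGSet (G : Type u) [Group G] : Type (u + 1) where
  carrier : Type u
  [finite : Finite carrier]
  [action : MulAction G carrier]

namespace FinGSet

variable {G : Type u} [Group G]

instance : CoeSort (FinGSet G) (Type u) := ⟨FinGSet.carrier⟩

instance (X : FinGSet G) : Finite X := X.finite

instance (X : FinGSet G) : MulAction G X := X.action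

/-- The one-point `G`-set. -/
def point (G : Type u) [Group G] : FinGSet G where
  carrier := PUnit.{u + 1}

/-- The empty `G`-set. -/
def empty (G : Type u) [Group G] : FinGSet G where
  carrier := PEmpty.{u + 1}
  action :=
    { smul := fun _ x => x
      one_smul := fun x => x.elim
      mul_smul := fun _ _ x => x.elim }

/-- The disjoint union of two finite `G`-sets. -/
def sum (X Y : FinGSet G) : FinGSet G where
  carrier := X ⊕ Y
  action :=
    { smul := fun g => Sum.map (g • ·) (g • ·)
      one_smul := by rintro (x | x) <;> exact congrArg _ (one_smul G x)
      mul_smul := by rintro g h (x | x) <;> exact congrArg _ (mul_smul g h x) }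

@[simp] theorem smul_inl (X Y : FinGSet G) (g : G) (x : X) :
    g • (Sum.inl x : X.sum Y) = (Sum.inl (g • x) : X.sum Y) := rfl

@[simp] theorem smul_inr (X Y : FinGSet G) (g : G) (y : Y) :
    g • (Sum.inr y : X.sum Y) = (Sum.inr (g • y) : X.sum Y) := rfl

/-- The cartesian product of two finite `G`-sets, with the diagonal action. -/
def prod (X Y : FinGSet G) : FinGSet G where
  carrier := X × Y

/-- The pullback of two equivariant maps of finite `G`-sets. -/
def pullback {X Y Z : FinGSet G} (f : X →[G] Z) (g : Y →[G] Z) : FinGSet G where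
  carrier := {p : X × Y // f p.1 = g p.2}
  action :=
    { smul := fun a p => ⟨(a • p.1.1, a • p.1.2), by rw [map_smul, map_smul, p.2]⟩
      one_smul := fun p => Subtype.ext (one_smul G p.1)
      mul_smul := fun a b p => Subtype.ext (mul_smul a b p.1) }

@[simp] theorem coe_smul_pullback {X Y Z : FinGSet G} (f : X →[G] Z) (g : Y →[G] Z) (a : G)
    (p : pullback f g) : (a • p).1 = (a • p.1.1, a • p.1.2) := rfl

/-- The orbit `G/H`. -/
def orbit [Finite G] (H : Subgroup G) : FinGSet G where
  carrier := G ⧸ H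

/-- The finite `G`-set obtained from a finite `Q`-set by letting `G` act through `φ : G → Q`. -/
def res {Q : Type u} [Group Q] (φ : G →* Q) (X : FinGSet Q) : FinGSet G where
  carrier := X
  action := MulAction.compHom X φ

/-- An equivariant map of `Q`-sets, seen as an equivariant map of `G`-sets along `φ : G → Q`. -/
def resMap {Q : Type u} [Group Q] (φ : G →* Q) {X Y : FinGSet Q} (f : X →[Q] Y) :
    res φ X →[G] res φ Y where
  toFun := f
  map_smul' g x := f.map_smul' (φ g) x

end FinGSet

variable {G : Type u} [Group G]

/-- A span `X ← A → Y` of finite `G`-sets. -/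
structure GSpan (X Y : FinGSet G) : Type (u + 1) where
  apex : FinGSet G
  l : apex →[G] X
  r : apex →[G] Y

namespace GSpan

variable {X Y Z W X' Y' Z' : FinGSet G}

/-- An isomorphism of spans: an equivariant bijection of the apexes over both feet. -/
structure Iso (S T : GSpan X Y) where
  e : S.apex ≃ T.apex
  smul : ∀ (g : G) (s : S.apex), e (g • s) = g • e s
  hl : ∀ s, T.l (e s) = S.l s
  hr : ∀ s, T.r (e s) = S.r s

instance setoid (X Y : FinGSet G) : Setoid (GSpan X Y) where
  r S T := Nonempty (Iso S T)
  iseqv :=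
    { refl := fun S => ⟨⟨Equiv.refl _, fun _ _ => rfl, fun _ => rfl, fun _ => rfl⟩⟩
      symm := fun {S T} ⟨i⟩ => ⟨⟨i.e.symm,
        fun g s => by rw [Equiv.symm_apply_eq, i.smul, Equiv.apply_symm_apply],
        fun s => by rw [← i.hl, Equiv.apply_symm_apply],
        fun s => by rw [← i.hr, Equiv.apply_symm_apply]⟩⟩
      trans := fun ⟨i⟩ ⟨j⟩ => ⟨⟨i.e.trans j.e,
        fun g s => by simp [i.smul, j.smul],
        fun s => by simp [j.hl, i.hl], fun s => by simp [j.hr, i.hr]⟩⟩ }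

/-- The identity span. -/
def id (X : FinGSet G) : GSpan X X := ⟨X, MulActionHom.id G, MulActionHom.id G⟩

/-- Composition of spans by pullback. -/
def comp (S : GSpan X Y) (T : GSpan Y Z) : GSpan X Z where
  apex := FinGSet.pullback S.r T.l
  l := { toFun := fun p => S.l p.1.1, map_smul' := fun g p => map_smul S.l g p.1.1 }
  r := { toFun := fun p => T.r p.1.2, map_smul' := fun g p => map_smul T.r g p.1.2 }

/-- The sum of two spans is their disjoint union. -/
def add (S T : GSpan X Y) : GSpan X Y where
  apex := S.apex.sum T.apex
  l := { toFun := Sum.elim S.l T.l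
         map_smul' := by rintro g (s | s) <;> exact map_smul _ g s }
  r := { toFun := Sum.elim S.r T.r
         map_smul' := by rintro g (s | s) <;> exact map_smul _ g s }

/-- The empty span. -/
def zero (X Y : FinGSet G) : GSpan X Y where
  apex := FinGSet.empty G
  l := { toFun := fun x => x.elim, map_smul' := fun _ x => x.elim }
  r := { toFun := fun x => x.elim, map_smul' := fun _ x => x.elim }

/-- The cartesian product of two spans. -/
def prod (S : GSpan X Y) (T : GSpan X' Y') : GSpan (X.prod X') (Y.prod Y') where
  apex := S.apex.prod T.apex
  l := { toFun := Prod.map S.l T.l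
         map_smul' := fun g p => Prod.ext (map_smul S.l g p.1) (map_smul T.l g p.2) }
  r := { toFun := Prod.map S.r T.r
         map_smul' := fun g p => Prod.ext (map_smul S.r g p.1) (map_smul T.r g p.2) }

/-- A span of finite `Q`-sets, seen as a span of finite `G`-sets along `φ : G → Q`. -/
def res {Q : Type u} [Group Q] (φ : G →* Q) {X Y : FinGSet Q} (S : GSpan X Y) :
    GSpan (FinGSet.res φ X) (FinGSet.res φ Y) where
  apex := FinGSet.res φ S.apex
  l := FinGSet.resMap φ S.l
  r := FinGSet.resMap φ S.r

end GSpan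

/-- Isomorphism classes of spans of finite `G`-sets. -/
def SpanClass (X Y : FinGSet G) : Type (u + 1) := Quotient (GSpan.setoid X Y)

namespace SpanClass

variable {X Y Z W X' Y' Z' : FinGSet G}

/-- The class of a span. -/
def mk (S : GSpan X Y) : SpanClass X Y := Quotient.mk _ S

theorem sound {S T : GSpan X Y} (i : GSpan.Iso S T) : mk S = mk T := Quotient.sound ⟨i⟩

theorem ind {p : SpanClass X Y → Prop} (h : ∀ S, p (mk S)) (a : SpanClass X Y) : p a :=
  Quotient.ind h a

instance : Zero (SpanClass X Y) := ⟨mk (GSpan.zero X Y)⟩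

instance : Add (SpanClass X Y) where
  add := Quotient.map₂ GSpan.add (by
    rintro S S' ⟨i⟩ T T' ⟨j⟩
    exact ⟨⟨Equiv.sumCongr i.e j.e,
      by rintro g (s | s)
         · exact congrArg Sum.inl (i.smul g s)
         · exact congrArg Sum.inr (j.smul g s),
      by rintro (s | s)
         · exact i.hl s
         · exact j.hl s,
      by rintro (s | s)
         · exact i.hr s
         · exact j.hr s⟩⟩)

theorem mk_add (S T : GSpan X Y) : mk S + mk T = mk (S.add T) := rfl

theorem zero_def : (0 : SpanClass X Y) = mk (GSpan.zero X Y) := rfl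

instance : AddCommMonoid (SpanClass X Y) where
  add_assoc a b c := by
    induction a using ind with | _ S
    induction b using ind with | _ T
    induction c using ind with | _ U
    exact sound ⟨Equiv.sumAssoc _ _ _, by rintro g ((s | s) | s) <;> rfl,
      by rintro ((s | s) | s) <;> rfl, by rintro ((s | s) | s) <;> rfl⟩
  zero_add a := by
    induction a using ind with | _ S
    exact sound ⟨Equiv.emptySum PEmpty S.apex, by rintro g (s | s); exacts [s.elim, rfl],
      by rintro (s | s); exacts [s.elim, rfl], by rintro (s | s); exacts [s.elim, rfl]⟩
  add_zero a := by
    induction a using ind with | _ S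
    exact sound ⟨Equiv.sumEmpty S.apex PEmpty, by rintro g (s | s); exacts [rfl, s.elim],
      by rintro (s | s); exacts [rfl, s.elim], by rintro (s | s); exacts [rfl, s.elim]⟩
  add_comm a b := by
    induction a using ind with | _ S
    induction b using ind with | _ T
    exact sound ⟨Equiv.sumComm _ _, by rintro g (s | s) <;> rfl,
      by rintro (s | s) <;> rfl, by rintro (s | s) <;> rfl⟩
  nsmul := nsmulRec

/-- Composition of classes of spans, on underlying sets. -/
def compFun : SpanClass X Y → SpanClass Y Z → SpanClass X Z :=
  Quotient.map₂ GSpan.comp (by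
    rintro S S' ⟨i⟩ T T' ⟨j⟩
    exact ⟨⟨(Equiv.prodCongr i.e j.e).subtypeEquiv (fun p => by
        change _ ↔ S'.r (i.e p.1) = T'.l (j.e p.2)
        rw [i.hr, j.hl]),
      fun g p => Subtype.ext (Prod.ext (i.smul g _) (j.smul g _)),
      fun p => i.hl _, fun p => j.hr _⟩⟩)

theorem compFun_mk (S : GSpan X Y) (T : GSpan Y Z) : compFun (mk S) (mk T) = mk (S.comp T) := rfl

/-- Composition of classes of spans, which is biadditive. -/
def comp : SpanClass X Y →+ SpanClass Y Z →+ SpanClass X Z where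
  toFun a :=
    { toFun := compFun a
      map_zero' := by
        induction a using ind with | _ S
        exact sound ⟨⟨fun p => p.1.2.elim, fun p => p.elim, fun p => p.1.2.elim, fun p => p.elim⟩,
          fun _ p => p.1.2.elim, fun p => p.1.2.elim, fun p => p.1.2.elim⟩
      map_add' := fun b c => by
        induction a using ind with | _ S
        induction b using ind with | _ T
        induction c using ind with | _ U
        refine sound ⟨⟨fun p => ?_, fun p => ?_, ?_, ?_⟩, ?_, ?_, ?_⟩
        · exact match p with
            | ⟨(s, Sum.inl t), h⟩ => Sum.inl ⟨(s, t), h⟩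
            | ⟨(s, Sum.inr t), h⟩ => Sum.inr ⟨(s, t), h⟩
        · exact match p with
            | Sum.inl q => ⟨(q.1.1, Sum.inl q.1.2), q.2⟩
            | Sum.inr q => ⟨(q.1.1, Sum.inr q.1.2), q.2⟩
        · rintro ⟨⟨s, t | t⟩, h⟩ <;> rfl
        · rintro (q | q) <;> rfl
        · rintro g ⟨⟨s, t | t⟩, h⟩ <;> rfl
        · rintro ⟨⟨s, t | t⟩, h⟩ <;> rfl
        · rintro ⟨⟨s, t | t⟩, h⟩ <;> rfl }
  map_zero' := by
    ext b
    induction b using ind with | _ T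
    exact sound ⟨⟨fun p => p.1.1.elim, fun p => p.elim, fun p => p.1.1.elim, fun p => p.elim⟩,
      fun _ p => p.1.1.elim, fun p => p.1.1.elim, fun p => p.1.1.elim⟩
  map_add' a b := by
    ext c
    induction a using ind with | _ S
    induction b using ind with | _ T
    induction c using ind with | _ U
    refine sound ⟨⟨fun p => ?_, fun p => ?_, ?_, ?_⟩, ?_, ?_, ?_⟩
    · exact match p with
        | ⟨(Sum.inl s, t), h⟩ => Sum.inl ⟨(s, t), h⟩
        | ⟨(Sum.inr s, t), h⟩ => Sum.inr ⟨(s, t), h⟩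
    · exact match p with
        | Sum.inl q => ⟨(Sum.inl q.1.1, q.1.2), q.2⟩
        | Sum.inr q => ⟨(Sum.inr q.1.1, q.1.2), q.2⟩
    · rintro ⟨⟨s | s, t⟩, h⟩ <;> rfl
    · rintro (q | q) <;> rfl
    · rintro g ⟨⟨s | s, t⟩, h⟩ <;> rfl
    · rintro ⟨⟨s | s, t⟩, h⟩ <;> rfl
    · rintro ⟨⟨s | s, t⟩, h⟩ <;> rfl

theorem comp_mk (S : GSpan X Y) (T : GSpan Y Z) : comp (mk S) (mk T) = mk (S.comp T) := rfl

theorem id_comp (a : SpanClass X Y) : comp (mk (GSpan.id X)) a = a := by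
  induction a using ind with | _ S
  exact sound ⟨⟨fun p => p.1.2, fun s => ⟨(S.l s, s), rfl⟩,
    fun p => Subtype.ext (Prod.ext p.2.symm rfl), fun _ => rfl⟩,
    fun _ _ => rfl, fun p => p.2.symm, fun _ => rfl⟩

theorem comp_id (a : SpanClass X Y) : comp a (mk (GSpan.id Y)) = a := by
  induction a using ind with | _ S
  exact sound ⟨⟨fun p => p.1.1, fun s => ⟨(s, S.r s), rfl⟩,
    fun p => Subtype.ext (Prod.ext rfl p.2), fun _ => rfl⟩,
    fun _ _ => rfl, fun _ => rfl, fun p => p.2⟩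

theorem comp_assoc (a : SpanClass X Y) (b : SpanClass Y Z) (c : SpanClass Z W) :
    comp (comp a b) c = comp a (comp b c) := by
  induction a using ind with | _ S
  induction b using ind with | _ T
  induction c using ind with | _ U
  exact sound ⟨⟨fun p => ⟨(p.1.1.1.1, ⟨(p.1.1.1.2, p.1.2), p.2⟩), p.1.1.2⟩,
    fun p => ⟨(⟨(p.1.1, p.1.2.1.1), p.2⟩, p.1.2.1.2), p.1.2.2⟩, fun _ => rfl, fun _ => rfl⟩,
    fun _ _ => rfl, fun _ => rfl, fun _ => rfl⟩

/-- The cartesian product of classes of spans, which is biadditive. -/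
def prod : SpanClass X Y →+ SpanClass X' Y' →+ SpanClass (X.prod X') (Y.prod Y') where
  toFun a :=
    { toFun := Quotient.map₂ GSpan.prod (by
        rintro S S' ⟨i⟩ T T' ⟨j⟩
        exact ⟨⟨Equiv.prodCongr i.e j.e,
          fun g p => Prod.ext (i.smul g _) (j.smul g _),
          fun p => Prod.ext (i.hl _) (j.hl _), fun p => Prod.ext (i.hr _) (j.hr _)⟩⟩) a
      map_zero' := by
        induction a using ind with | _ S
        exact sound ⟨⟨fun p => p.2.elim, fun p => p.elim, fun p => p.2.elim, fun p => p.elim⟩,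
          fun _ p => p.2.elim, fun p => p.2.elim, fun p => p.2.elim⟩
      map_add' := fun b c => by
        induction a using ind with | _ S
        induction b using ind with | _ T
        induction c using ind with | _ U
        exact sound ⟨Equiv.prodSumDistrib _ _ _, by rintro g ⟨s, t | t⟩ <;> rfl,
          by rintro ⟨s, t | t⟩ <;> rfl, by rintro ⟨s, t | t⟩ <;> rfl⟩ }
  map_zero' := by
    ext b
    induction b using ind with | _ T
    exact sound ⟨⟨fun p => p.1.elim, fun p => p.elim, fun p => p.1.elim, fun p => p.elim⟩,
      fun _ p => p.1.elim, fun p => p.1.elim, fun p => p.1.elim⟩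
  map_add' a b := by
    ext c
    induction a using ind with | _ S
    induction b using ind with | _ T
    induction c using ind with | _ U
    exact sound ⟨Equiv.sumProdDistrib _ _ _, by rintro g ⟨s | s, t⟩ <;> rfl,
      by rintro ⟨s | s, t⟩ <;> rfl, by rintro ⟨s | s, t⟩ <;> rfl⟩

theorem prod_mk (S : GSpan X Y) (T : GSpan X' Y') : prod (mk S) (mk T) = mk (S.prod T) := rfl

theorem prod_id (X X' : FinGSet G) :
    prod (mk (GSpan.id X)) (mk (GSpan.id X')) = mk (GSpan.id (X.prod X')) := rfl

theorem prod_comp (a : SpanClass X Y) (b : SpanClass Y Z) (a' : SpanClass X' Y')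
    (b' : SpanClass Y' Z') : prod (comp a b) (comp a' b') = comp (prod a a') (prod b b') := by
  induction a using ind with | _ S
  induction b using ind with | _ T
  induction a' using ind with | _ S'
  induction b' using ind with | _ T'
  exact sound ⟨⟨fun p => ⟨((p.1.1.1, p.2.1.1), (p.1.1.2, p.2.1.2)), Prod.ext p.1.2 p.2.2⟩,
    fun p => (⟨(p.1.1.1, p.1.2.1), congrArg Prod.fst p.2⟩,
      ⟨(p.1.1.2, p.1.2.2), congrArg Prod.snd p.2⟩), fun _ => rfl, fun _ => rfl⟩,
    fun _ _ => rfl, fun _ => rfl, fun _ => rfl⟩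

/-- Classes of spans of finite `Q`-sets as classes of spans of finite `G`-sets. -/
def res {Q : Type u} [Group Q] (φ : G →* Q) {X Y : FinGSet Q} :
    SpanClass X Y →+ SpanClass (FinGSet.res φ X) (FinGSet.res φ Y) where
  toFun := Quotient.map (GSpan.res φ) (by
    rintro S S' ⟨i⟩
    exact ⟨⟨i.e, fun g s => i.smul (φ g) s, i.hl, i.hr⟩⟩)
  map_zero' := sound ⟨Equiv.refl _, fun _ x => x.elim, fun x => x.elim, fun x => x.elim⟩
  map_add' a b := by
    induction a using ind with | _ S
    induction b using ind with | _ T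
    exact sound ⟨Equiv.refl _, by rintro g (s | s) <;> rfl,
      by rintro (s | s) <;> rfl, by rintro (s | s) <;> rfl⟩

theorem res_id {Q : Type u} [Group Q] (φ : G →* Q) (X : FinGSet Q) :
    res φ (mk (GSpan.id X)) = mk (GSpan.id (FinGSet.res φ X)) := rfl

theorem res_comp {Q : Type u} [Group Q] (φ : G →* Q) {X Y Z : FinGSet Q}
    (a : SpanClass X Y) (b : SpanClass Y Z) : res φ (comp a b) = comp (res φ a) (res φ b) := by
  induction a using ind with | _ S
  induction b using ind with | _ T
  exact sound ⟨Equiv.refl _, fun _ _ => rfl, fun _ => rfl, fun _ => rfl⟩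

end SpanClass

/-! ### The Burnside category -/

section GroupCompletion

open Algebra

variable {A B C : Type*} [AddCommMonoid A] [AddCommMonoid B] [AddCommMonoid C]

theorem groupCompletion_lift_of {D : Type*} [AddCommGroup D] (f : A →+ D) (a : A) :
    GrothendieckAddGroup.lift f (GrothendieckAddGroup.of a) = f a :=
  DFunLike.congr_fun (GrothendieckAddGroup.lift.symm_apply_apply f) a

theorem groupCompletion_hom_ext {D : Type*} [AddCommGroup D] {f g : GrothendieckAddGroup A →+ D}
    (h : ∀ a, f (GrothendieckAddGroup.of a) = g (GrothendieckAddGroup.of a)) : f = g :=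
  GrothendieckAddGroup.lift.symm.injective (AddMonoidHom.ext h)

/-- The biadditive map of group completions induced by a biadditive map of commutative monoids. -/
noncomputable def groupCompletionMap₂ (f : A →+ B →+ C) :
    GrothendieckAddGroup A →+ GrothendieckAddGroup B →+ GrothendieckAddGroup C :=
  GrothendieckAddGroup.lift
    { toFun := fun a => GrothendieckAddGroup.lift (GrothendieckAddGroup.of.comp (f a))
      map_zero' := groupCompletion_hom_ext fun b => by
        rw [groupCompletion_lift_of, map_zero, AddMonoidHom.comp_zero]; rfl
      map_add' := fun a a' => groupCompletion_hom_ext fun b => by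
        rw [AddMonoidHom.add_apply, groupCompletion_lift_of, groupCompletion_lift_of,
          groupCompletion_lift_of, map_add, AddMonoidHom.comp_add]; rfl }

theorem groupCompletionMap₂_of (f : A →+ B →+ C) (a : A) (b : B) :
    groupCompletionMap₂ f (GrothendieckAddGroup.of a) (GrothendieckAddGroup.of b) =
      GrothendieckAddGroup.of (f a b) :=
  (DFunLike.congr_fun (groupCompletion_lift_of _ a) _).trans (groupCompletion_lift_of _ b)

/-- The map of group completions induced by a map of commutative monoids. -/
noncomputable def groupCompletionMap (f : A →+ B) :
    GrothendieckAddGroup A →+ GrothendieckAddGroup B :=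
  GrothendieckAddGroup.lift (GrothendieckAddGroup.of.comp f)

theorem groupCompletionMap_of (f : A →+ B) (a : A) :
    groupCompletionMap f (GrothendieckAddGroup.of a) = GrothendieckAddGroup.of (f a) :=
  groupCompletion_lift_of _ a

theorem groupCompletion_induction {p : GrothendieckAddGroup A → Prop}
    (h : ∀ a, p (GrothendieckAddGroup.of a)) (hs : ∀ x y, p x → p y → p (x - y))
    (x : GrothendieckAddGroup A) : p x := by
  have hx : GrothendieckAddGroup.lift GrothendieckAddGroup.of x = x :=
    DFunLike.congr_fun (groupCompletion_hom_ext (f := GrothendieckAddGroup.lift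
      GrothendieckAddGroup.of) (g := AddMonoidHom.id _) fun a => groupCompletion_lift_of _ a) x
  rw [← hx, GrothendieckAddGroup.lift_apply]
  exact hs _ _ (h _) (h _)

end GroupCompletion

/-- The group of morphisms from `X` to `Y` in the Burnside category: the group completion of the
commutative monoid of isomorphism classes of spans from `X` to `Y`. -/
def BurnsideHom (X Y : FinGSet G) : Type (u + 1) :=
  Algebra.GrothendieckAddGroup (SpanClass X Y)

namespace BurnsideHom

variable {X Y Z W X' Y' Z' : FinGSet G}

noncomputable instance : AddCommGroup (BurnsideHom X Y) :=
  inferInstanceAs (AddCommGroup (Algebra.GrothendieckAddGroup (SpanClass X Y)))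

/-- The morphism of the Burnside category given by a class of spans. -/
noncomputable def of : SpanClass X Y →+ BurnsideHom X Y := Algebra.GrothendieckAddGroup.of

/-- Every morphism of the Burnside category is a difference of classes of spans. -/
theorem induction {p : BurnsideHom X Y → Prop} (h : ∀ a, p (of a))
    (hs : ∀ x y, p x → p y → p (x - y)) (f : BurnsideHom X Y) : p f :=
  groupCompletion_induction h hs f

/-- Composition in the Burnside category. -/
noncomputable def comp : BurnsideHom X Y →+ BurnsideHom Y Z →+ BurnsideHom X Z :=
  groupCompletionMap₂ SpanClass.comp

theorem comp_of (a : SpanClass X Y) (b : SpanClass Y Z) :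
    comp (of a) (of b) = of (SpanClass.comp a b) := groupCompletionMap₂_of _ _ _

theorem id_comp (f : BurnsideHom X Y) : comp (of (SpanClass.mk (GSpan.id X))) f = f := by
  induction f using induction with
  | h a => rw [comp_of, SpanClass.id_comp]
  | hs x y hx hy => rw [map_sub, hx, hy]

theorem comp_id (f : BurnsideHom X Y) : comp f (of (SpanClass.mk (GSpan.id Y))) = f := by
  induction f using induction with
  | h a => rw [comp_of, SpanClass.comp_id]
  | hs x y hx hy => rw [map_sub, AddMonoidHom.sub_apply, hx, hy]

theorem comp_assoc (f : BurnsideHom X Y) (g : BurnsideHom Y Z) (k : BurnsideHom Z W) :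
    comp (comp f g) k = comp f (comp g k) := by
  induction f using induction with
  | hs x y hx hy => simp only [map_sub, AddMonoidHom.sub_apply, hx, hy]
  | h a =>
    induction g using induction with
    | hs x y hx hy => simp only [map_sub, AddMonoidHom.sub_apply, hx, hy]
    | h b =>
      induction k using induction with
      | hs x y hx hy => simp only [map_sub, hx, hy]
      | h c => simp only [comp_of, SpanClass.comp_assoc]

theorem add_comp (f g : BurnsideHom X Y) (h : BurnsideHom Y Z) :
    comp (f + g) h = comp f h + comp g h := by rw [map_add]; rfl

theorem comp_add (f : BurnsideHom X Y) (g h : BurnsideHom Y Z) :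
    comp f (g + h) = comp f g + comp f h := map_add _ _ _

/-- The cartesian product of morphisms of the Burnside category. -/
noncomputable def prod : BurnsideHom X Y →+ BurnsideHom X' Y' →+
    BurnsideHom (X.prod X') (Y.prod Y') :=
  groupCompletionMap₂ SpanClass.prod

theorem prod_of (a : SpanClass X Y) (b : SpanClass X' Y') :
    prod (of a) (of b) = of (SpanClass.prod a b) := groupCompletionMap₂_of _ _ _

theorem prod_comp (f : BurnsideHom X Y) (g : BurnsideHom Y Z) (f' : BurnsideHom X' Y')
    (g' : BurnsideHom Y' Z') : prod (comp f g) (comp f' g') = comp (prod f f') (prod g g') := by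
  induction f using induction with
  | hs x y hx hy => simp only [map_sub, AddMonoidHom.sub_apply, hx, hy]
  | h a =>
    induction g using induction with
    | hs x y hx hy => simp only [map_sub, AddMonoidHom.sub_apply, hx, hy]
    | h b =>
      induction f' using induction with
      | hs x y hx hy => simp only [map_sub, AddMonoidHom.sub_apply, hx, hy]
      | h a' =>
        induction g' using induction with
        | hs x y hx hy => simp only [map_sub, hx, hy]
        | h b' => simp only [comp_of, prod_of, SpanClass.prod_comp]

/-- Morphisms of the Burnside category of `Q`, seen as morphisms of the Burnside category of `G`
along `φ : G → Q`. -/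
noncomputable def res {Q : Type u} [Group Q] (φ : G →* Q) {X Y : FinGSet Q} :
    BurnsideHom X Y →+ BurnsideHom (FinGSet.res φ X) (FinGSet.res φ Y) :=
  groupCompletionMap (SpanClass.res φ)

theorem res_of {Q : Type u} [Group Q] (φ : G →* Q) {X Y : FinGSet Q} (a : SpanClass X Y) :
    res φ (of a) = of (SpanClass.res φ a) := groupCompletionMap_of _ _

theorem res_comp {Q : Type u} [Group Q] (φ : G →* Q) {X Y Z : FinGSet Q}
    (f : BurnsideHom X Y) (g : BurnsideHom Y Z) :
    res φ (comp f g) = comp (res φ f) (res φ g) := by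
  induction f using induction with
  | hs x y hx hy => simp only [map_sub, AddMonoidHom.sub_apply, hx, hy]
  | h a =>
    induction g using induction with
    | hs x y hx hy => simp only [map_sub, hx, hy]
    | h b => simp only [comp_of, res_of, SpanClass.res_comp]

end BurnsideHom

/-- The Burnside category of `G`: its objects are the finite `G`-sets, and its hom groups are the
group completions of the commutative monoids of isomorphism classes of spans. -/
structure BurnsideCat (G : Type u) [Group G] : Type (u + 1) where
  gset : FinGSet G

namespace BurnsideCat

noncomputable instance : Category.{u + 1} (BurnsideCat G) where
  Hom X Y := BurnsideHom X.gset Y.gset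
  id X := BurnsideHom.of (SpanClass.mk (GSpan.id X.gset))
  comp f g := BurnsideHom.comp f g
  id_comp := BurnsideHom.id_comp
  comp_id := BurnsideHom.comp_id
  assoc := BurnsideHom.comp_assoc

noncomputable instance : Preadditive (BurnsideCat G) where
  homGroup X Y := inferInstanceAs (AddCommGroup (BurnsideHom X.gset Y.gset))
  add_comp _ _ _ := BurnsideHom.add_comp
  comp_add _ _ _ := BurnsideHom.comp_add

/-- The functor `(X, Y) ↦ X × Y` on the Burnside category. -/
noncomputable def prodFunctor (G : Type u) [Group G] :
    BurnsideCat G × BurnsideCat G ⥤ BurnsideCat G where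
  obj X := ⟨X.1.gset.prod X.2.gset⟩
  map f := BurnsideHom.prod f.1 f.2
  map_id X := (BurnsideHom.prod_of _ _).trans
    (congrArg BurnsideHom.of (SpanClass.prod_id X.1.gset X.2.gset))
  map_comp f g := BurnsideHom.prod_comp f.1 g.1 f.2 g.2

/-- The functor from the Burnside category of `Q` to that of `G` which regards diagrams of finite
`Q`-sets as diagrams of finite `G`-sets along `φ : G → Q`. -/
noncomputable def res {Q : Type u} [Group Q] (φ : G →* Q) : BurnsideCat Q ⥤ BurnsideCat G where
  obj X := ⟨FinGSet.res φ X.gset⟩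
  map f := BurnsideHom.res φ f
  map_id _ := BurnsideHom.res_of φ _
  map_comp f g := BurnsideHom.res_comp φ f g

instance {Q : Type u} [Group Q] (φ : G →* Q) : (res φ).Additive where
  map_add {_ _ f g} := map_add (BurnsideHom.res φ) f g

/-- The morphism `X → X ⊔ X` given by the left (`b = true`) or right inclusion. -/
noncomputable def incl (X : BurnsideCat G) (b : Bool) : X ⟶ ⟨X.gset.sum X.gset⟩ :=
  BurnsideHom.of (SpanClass.mk
    { apex := X.gset
      l := MulActionHom.id G
      r := { toFun := fun x => cond b (Sum.inl x) (Sum.inr x)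
             map_smul' := by cases b <;> exact fun _ _ => rfl } })

/-- The morphism `X ⊔ X → X` which restricts to the left (`b = true`) or right summand. -/
noncomputable def proj (X : BurnsideCat G) (b : Bool) :
    (⟨X.gset.sum X.gset⟩ : BurnsideCat G) ⟶ X :=
  BurnsideHom.of (SpanClass.mk
    { apex := X.gset
      l := { toFun := fun x => cond b (Sum.inl x) (Sum.inr x)
             map_smul' := by cases b <;> exact fun _ _ => rfl }
      r := MulActionHom.id G })

theorem incl_proj_self (X : BurnsideCat G) (b : Bool) : X.incl b ≫ X.proj b = 𝟙 X := by
  refine (BurnsideHom.comp_of _ _).trans (congrArg BurnsideHom.of (SpanClass.sound ?_))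
  refine ⟨⟨fun p => p.1.1, fun x => ⟨(x, x), rfl⟩, fun p => Subtype.ext (Prod.ext rfl ?_),
    fun _ => rfl⟩, fun _ _ => rfl, fun _ => rfl, fun p => ?_⟩
  · obtain ⟨⟨x, y⟩, h⟩ := p
    cases b
    · exact Sum.inr_injective h
    · exact Sum.inl_injective h
  · obtain ⟨⟨x, y⟩, h⟩ := p
    cases b
    · exact Sum.inr_injective h
    · exact Sum.inl_injective h

theorem incl_proj_of_ne (X : BurnsideCat G) {b c : Bool} (hbc : b ≠ c) :
    X.incl b ≫ X.proj c = 0 := by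
  refine (BurnsideHom.comp_of _ _).trans
    ((congrArg BurnsideHom.of (SpanClass.sound (T := GSpan.zero X.gset X.gset) ?_)).trans
      (map_zero BurnsideHom.of))
  have h : ∀ x y : X.gset, (cond b (Sum.inl x) (Sum.inr x) : X.gset ⊕ X.gset) ≠
      cond c (Sum.inl y) (Sum.inr y) := by
    cases b <;> cases c <;> simp_all
  exact ⟨⟨fun p => (h _ _ p.2).elim, fun p => p.elim, fun p => (h _ _ p.2).elim,
    fun p => p.elim⟩, fun _ p => (h _ _ p.2).elim, fun p => (h _ _ p.2).elim,
    fun p => (h _ _ p.2).elim⟩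

end BurnsideCat

/-! ### Mackey functors and the box product -/

/-- A Mackey functor for `G` is an additive functor from the Burnside category of `G` to abelian
groups; morphisms are natural transformations.  (Finite `G`-sets live in `Type u`, so that the
Burnside category is small relative to abelian groups in `Type (u + 1)`.) -/
abbrev MackeyFunctor (G : Type u) [Group G] : Type (u + 2) :=
  BurnsideCat G ⥤+ AddCommGrpCat.{u + 1}

/-- The tensor product of abelian groups, as a functor of two variables. -/
noncomputable def tensorAb : AddCommGrpCat.{u + 1} × AddCommGrpCat.{u + 1} ⥤
    AddCommGrpCat.{u + 1} where
  obj A := AddCommGrpCat.of (A.1 ⊗[ℤ] A.2)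
  map f := AddCommGrpCat.ofHom
    (TensorProduct.map f.1.hom.toIntLinearMap f.2.hom.toIntLinearMap).toAddMonoidHom
  map_id A := by
    ext x
    exact DFunLike.congr_fun (TensorProduct.map_id (R := ℤ) (M := A.1) (N := A.2)) x
  map_comp {A B C} f g := by
    ext x
    exact DFunLike.congr_fun (TensorProduct.map_comp (R := ℤ) g.1.hom.toIntLinearMap
      g.2.hom.toIntLinearMap f.1.hom.toIntLinearMap f.2.hom.toIntLinearMap) x

namespace MackeyFunctor

/-- The functor `(X, Y) ↦ M(X) ⊗ N(Y)`, for Mackey functors `M` and `N`. -/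
noncomputable def externalTensor (G : Type u) [Group G] : MackeyFunctor G × MackeyFunctor G ⥤
    (BurnsideCat G × BurnsideCat G ⥤ AddCommGrpCat.{u + 1}) where
  obj P := P.1.obj.prod P.2.obj ⋙ tensorAb
  map α := Functor.whiskerRight (NatTrans.prod α.1.hom α.2.hom) tensorAb
  map_id P := NatTrans.ext (funext fun X => tensorAb.map_id (P.1.obj.obj X.1, P.2.obj.obj X.2))
  map_comp {P P' P''} α β := NatTrans.ext (funext fun X =>
    tensorAb.map_comp (X := (P.1.obj.obj X.1, P.2.obj.obj X.2))
      (Y := (P'.1.obj.obj X.1, P'.2.obj.obj X.2)) (Z := (P''.1.obj.obj X.1, P''.2.obj.obj X.2))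
      (α.1.hom.app X.1, α.2.hom.app X.2) (β.1.hom.app X.1, β.2.hom.app X.2))

theorem tensorAb_map_add_left {A B : AddCommGrpCat.{u + 1} × AddCommGrpCat.{u + 1}}
    (f g : A.1 ⟶ B.1) (h : A.2 ⟶ B.2) :
    tensorAb.map (show A ⟶ B from (f + g, h)) =
      tensorAb.map (show A ⟶ B from (f, h)) + tensorAb.map (show A ⟶ B from (g, h)) := by
  ext x
  exact DFunLike.congr_fun (TensorProduct.map_add_left (R := ℤ) f.hom.toIntLinearMap
    g.hom.toIntLinearMap h.hom.toIntLinearMap) x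

theorem externalTensor_map_add (P : MackeyFunctor G × MackeyFunctor G) {X X' Y : BurnsideCat G}
    (f g : X ⟶ X') :
    ((externalTensor G).obj P).map (show (X, Y) ⟶ (X', Y) from (f + g, 𝟙 Y)) =
      ((externalTensor G).obj P).map (show (X, Y) ⟶ (X', Y) from (f, 𝟙 Y)) +
      ((externalTensor G).obj P).map (show (X, Y) ⟶ (X', Y) from (g, 𝟙 Y)) := by
  refine Eq.trans ?_ (tensorAb_map_add_left (A := (P.1.obj.obj X, P.2.obj.obj Y))
    (B := (P.1.obj.obj X', P.2.obj.obj Y)) (P.1.obj.map f) (P.1.obj.map g) (P.2.obj.map (𝟙 Y)))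
  rw [← P.1.obj.map_add]
  rfl

/-- The left Kan extension of `M ⊗ N` along the cartesian product is again additive. -/
theorem additive_lan (P : MackeyFunctor G × MackeyFunctor G) :
    ((BurnsideCat.prodFunctor G).lan.obj ((externalTensor G).obj P)).Additive := by
  set p := BurnsideCat.prodFunctor G
  set E := (externalTensor G).obj P
  let L := p.lan.obj E
  let v : E ⟶ p ⋙ L := p.lanUnit.app E
  have hv : (Functor.LeftExtension.mk L v).IsPointwiseLeftKanExtension :=
    Functor.isPointwiseLeftKanExtensionOfIsLeftKanExtension L v
  have nat : ∀ {X X' Y : BurnsideCat G} (f : X ⟶ X'),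
      E.map (show (X, Y) ⟶ (X', Y) from (f, 𝟙 Y)) ≫ v.app (X', Y) =
        v.app (X, Y) ≫ L.map (p.map (show (X, Y) ⟶ (X', Y) from (f, 𝟙 Y))) :=
    fun f => v.naturality _
  have key : ∀ {X Y Z : BurnsideCat G} (f g : p.obj (X, Y) ⟶ Z),
      v.app (X, Y) ≫ L.map (f + g) = v.app (X, Y) ≫ L.map f + v.app (X, Y) ≫ L.map g := by
    intro X Y Z f g
    let D : BurnsideCat G := ⟨X.gset.sum X.gset⟩
    let ι (b : Bool) : (X, Y) ⟶ (D, Y) := (X.incl b, 𝟙 Y)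
    let π (b : Bool) : (D, Y) ⟶ (X, Y) := (X.proj b, 𝟙 Y)
    let δ : (X, Y) ⟶ (D, Y) := (X.incl true + X.incl false, 𝟙 Y)
    have hδ : p.map δ = p.map (ι true) + p.map (ι false) := by
      exact DFunLike.congr_fun (map_add BurnsideHom.prod (X.incl true) (X.incl false)) _
    have hs : ∀ b, p.map (ι b) ≫ p.map (π b) = 𝟙 _ := by
      intro b
      rw [← p.map_comp, ← p.map_id]
      exact congrArg p.map (Prod.ext (X.incl_proj_self b) (Category.comp_id _))
    have hn : ∀ {b c}, b ≠ c → p.map (ι b) ≫ p.map (π c) = 0 := by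
      intro b c hbc
      rw [← p.map_comp]
      have h0 : ι b ≫ π c = (0, 𝟙 Y) :=
        Prod.ext (X.incl_proj_of_ne hbc) (Category.comp_id _)
      rw [h0]
      exact DFunLike.congr_fun (map_zero BurnsideHom.prod) _
    let d : p.obj (D, Y) ⟶ Z := p.map (π true) ≫ f + p.map (π false) ≫ g
    have h1 : p.map (ι true) ≫ d = f := by
      simp only [d, Preadditive.comp_add, ← Category.assoc, hs, hn (show true ≠ false by decide),
        Category.id_comp, zero_comp, add_zero]
    have h2 : p.map (ι false) ≫ d = g := by
      simp only [d, Preadditive.comp_add, ← Category.assoc, hs, hn (show false ≠ true by decide),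
        Category.id_comp, zero_comp, zero_add]
    have h3 : f + g = p.map δ ≫ d := by rw [hδ, Preadditive.add_comp, h1, h2]
    have n1 := nat (Y := Y) (X.incl true)
    have n2 := nat (Y := Y) (X.incl false)
    have n3 := nat (Y := Y) (X.incl true + X.incl false)
    rw [externalTensor_map_add, Preadditive.add_comp, n1, n2] at n3
    rw [h3, L.map_comp, ← Category.assoc]
    erw [← n3]
    rw [Preadditive.add_comp, Category.assoc, Category.assoc, ← L.map_comp, ← L.map_comp]
    exact congrArg₂ (fun a b => v.app (X, Y) ≫ L.map a + v.app (X, Y) ≫ L.map b) h1 h2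
  refine ⟨fun {Z W f g} => (hv Z).hom_ext fun j => ?_⟩
  have hι : ∀ k : Z ⟶ W, ((Functor.LeftExtension.mk L v).coconeAt Z).ι.app j ≫ L.map k =
      v.app j.left ≫ L.map (j.hom ≫ k) := by
    intro k
    rw [L.map_comp]
    exact Category.assoc _ _ _
  have h := key (X := j.left.1) (Y := j.left.2) (j.hom ≫ f) (j.hom ≫ g)
  rw [← Preadditive.comp_add] at h
  refine (hι (f + g)).trans (h.trans ?_)
  refine Eq.trans ?_ (Preadditive.comp_add _ _ _ _ (L.map f) (L.map g)).symm
  exact (congrArg₂ (· + ·) (hι f) (hι g)).symm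

/-- The box product of Mackey functors: the left Kan extension of `(X, Y) ↦ M(X) ⊗ N(Y)` along
the functor `(X, Y) ↦ X × Y`. -/
noncomputable def box (G : Type u) [Group G] :
    MackeyFunctor G × MackeyFunctor G ⥤ MackeyFunctor G :=
  (additiveFunctor _ _).lift (externalTensor G ⋙ (BurnsideCat.prodFunctor G).lan) additive_lan

/-- A Mackey functor `M` is flat if the functor `- ⊠ M` is exact. -/
def IsFlat (M : MackeyFunctor G) : Prop :=
  exactFunctor _ _ (Prod.sectL (MackeyFunctor G) M ⋙ box G)

/-! ### Geometric fixed points -/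

/-- The Burnside Mackey functor, `X ↦ 𝒜(*, X)`. -/
noncomputable def burnside (G : Type u) [Group G] : MackeyFunctor G :=
  AdditiveFunctor.of (preadditiveCoyoneda.obj (Opposite.op ⟨FinGSet.point G⟩))

section Generated

variable [Finite G] (M : MackeyFunctor G) (𝓕 : Set (Subgroup G))

/-- The value at `X` of the sub-Mackey functor of `M` generated by the groups `M(G/H)`, `H ∈ 𝓕`. -/
def generatedBy (X : BurnsideCat G) : AddSubgroup (M.obj.obj X) :=
  AddSubgroup.closure {y | ∃ H ∈ 𝓕, ∃ (f : (⟨FinGSet.orbit H⟩ : BurnsideCat G) ⟶ X)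
    (a : M.obj.obj ⟨FinGSet.orbit H⟩), M.obj.map f a = y}

/-- The generated subgroups do form a sub-Mackey functor. -/
theorem generatedBy_map {X Y : BurnsideCat G} (g : X ⟶ Y) :
    generatedBy M 𝓕 X ≤ (generatedBy M 𝓕 Y).comap (M.obj.map g).hom := by
  refine (AddSubgroup.closure_le _).2 ?_
  rintro _ ⟨H, hH, f, a, rfl⟩
  refine AddSubgroup.subset_closure ⟨H, hH, f ≫ g, a, ?_⟩
  rw [M.obj.map_comp]
  rfl

/-- The generated sub-Mackey functor contains `M(G/H)` for all `H ∈ 𝓕`. -/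
theorem generatedBy_orbit {H : Subgroup G} (hH : H ∈ 𝓕) :
    generatedBy M 𝓕 ⟨FinGSet.orbit H⟩ = ⊤ :=
  top_unique fun a _ => AddSubgroup.subset_closure ⟨H, hH, 𝟙 _, a, by rw [M.obj.map_id]; rfl⟩

/-- The generated sub-Mackey functor is the smallest one containing `M(G/H)` for all `H ∈ 𝓕`. -/
theorem generatedBy_le (S : ∀ X : BurnsideCat G, AddSubgroup (M.obj.obj X))
    (hS : ∀ {X Y : BurnsideCat G} (g : X ⟶ Y), S X ≤ (S Y).comap (M.obj.map g).hom)
    (h𝓕 : ∀ H ∈ 𝓕, S ⟨FinGSet.orbit H⟩ = ⊤) (X : BurnsideCat G) : generatedBy M 𝓕 X ≤ S X := by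
  refine (AddSubgroup.closure_le _).2 ?_
  rintro _ ⟨H, hH, f, a, rfl⟩
  exact hS f (by rw [h𝓕 H hH]; trivial)

/-- The quotient of `M` by the sub-Mackey functor generated by the groups `M(G/H)`, `H ∈ 𝓕`. -/
noncomputable def quotientBy : MackeyFunctor G where
  obj :=
    { obj := fun X => AddCommGrpCat.of (M.obj.obj X ⧸ generatedBy M 𝓕 X)
      map := fun {X Y} g => AddCommGrpCat.ofHom
        (QuotientAddGroup.map _ _ (M.obj.map g).hom (generatedBy_map M 𝓕 g))
      map_id := fun X => by
        ext x
        exact congrArg _ (ConcreteCategory.congr_hom (M.obj.map_id X) x)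
      map_comp := fun f g => by
        ext x
        exact congrArg _ (ConcreteCategory.congr_hom (M.obj.map_comp f g) x) }
  property :=
    { map_add := fun {X Y f g} => by
        ext x
        exact congrArg _ (ConcreteCategory.congr_hom (M.obj.map_add (f := f) (g := g)) x) }

end Generated

/-- The Mackey functor `ẼF_N`: the quotient of the Burnside Mackey functor by the sub-Mackey
functor generated by its values at `G/H` for all subgroups `H` which do not contain `N`. -/
noncomputable def tildeE [Finite G] (N : Subgroup G) : MackeyFunctor G :=
  quotientBy (burnside G) {H | ¬ N ≤ H}

/-- The functor `q_*` from `G`-Mackey functors to `G/N`-Mackey functors: precomposition with the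
functor of Burnside categories which regards `G/N`-sets as `G`-sets. -/
noncomputable def qLowerStar (N : Subgroup G) [N.Normal] :
    MackeyFunctor G ⥤ MackeyFunctor (G ⧸ N) :=
  (additiveFunctor _ _).lift
    (AdditiveFunctor.forget _ _ ⋙ (Functor.whiskeringLeft _ _ _).obj
      (BurnsideCat.res (QuotientGroup.mk' N)))
    fun M => inferInstanceAs (BurnsideCat.res (QuotientGroup.mk' N) ⋙ M.obj).Additive

/-- The `N`-geometric fixed points functor `Φ^N = q_* ∘ (ẼF_N ⊠ -)`. -/
noncomputable def geometricFixedPoints [Finite G] (N : Subgroup G) [N.Normal] :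
    MackeyFunctor G ⥤ MackeyFunctor (G ⧸ N) :=
  Prod.sectR (tildeE N) (MackeyFunctor G) ⋙ box G ⋙ qLowerStar N

end MackeyFunctor

end EquivariantAlgebra

/-! The theorem follows from a projection formula `L ⊠ Φ^N M ≅ q_*(L' ⊠ M)`, natural in the
`Q`-Mackey functor `L`, where `L'(X) = L(X^N)` is the inflation of `L`. Inflation and `q_*` are
precompositions with additive functors, hence exact, and `- ⊠ M` is exact by hypothesis; so `- ⊠ Φ^N
M` is exact.

The formula is proved on right adjoints. Call a `G`-Mackey functor geometric if it vanishes on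
`G`-sets without `N`-fixed points. On these, `q_*` is an equivalence with inverse inflation
(`geometricEquivalence`), because a geometric functor sees only the fixed points of a span. Both `-
⊠ M` and its right adjoint `internalHom M` preserve them (`geometric_box`, `geometric_internalHom`),
so `L ↦ q_*(L' ⊠ M)` has right adjoint `K ↦ q_*(internalHom M K')`.

By Yoneda, maps from `ẼF_N` to a geometric `W` are elements of `W(*)` (`tildeE_bijective`). Hence
`ẼF_N ⊠ M` is the geometric reflection of `M`, and `Φ^N` is left adjoint to inflation
(`toInflation_bijective`). Since fixed points commute with products, `Hom(Φ^N M, K(X × -)) ≅ Hom(M,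
K'(q^*X × -))`, so the two right adjoints agree, and therefore the left adjoints do. -/

namespace EquivariantAlgebra

/-! ### Exactness of precomposition with additive functors. -/

section Precomposition

variable {C D E : Type*} [Category* C] [Category* D] [Category* E] [Preadditive C] [Preadditive D]
  [Preadditive E] (J : Type*) [Category* J]

/-- Limits of functors are pointwise, so the projections at `Y` are jointly monic; naturality moves
each of them past `F.map`, where the additivity of the diagram functors applies. -/
theorem additiveFunctor_isClosedUnderLimitsOfShape [HasLimitsOfShape J E] :
    (additiveFunctor C E).IsClosedUnderLimitsOfShape J where
  limitsOfShape_le := by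
    rintro F ⟨p, hp⟩
    refine ⟨fun {X Y f g} => ?_⟩
    refine (isLimitOfPreserves ((evaluation C E).obj Y) p.isLimit).hom_ext fun j => ?_
    have := hp j
    have h : ∀ k : X ⟶ Y, F.map k ≫ (p.π.app j).app Y = (p.π.app j).app X ≫ (p.diag.obj j).map k :=
      fun k => (p.π.app j).naturality k
    have hadd : (p.diag.obj j).map (f + g) = (p.diag.obj j).map f + (p.diag.obj j).map g :=
      (show (p.diag.obj j).Additive from hp j).map_add
    change F.map (f + g) ≫ (p.π.app j).app Y = (F.map f + F.map g) ≫ (p.π.app j).app Y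
    rw [h, hadd, Preadditive.comp_add, Preadditive.add_comp, h, h]

theorem additiveFunctor_isClosedUnderColimitsOfShape [HasColimitsOfShape J E] :
    (additiveFunctor C E).IsClosedUnderColimitsOfShape J where
  colimitsOfShape_le := by
    rintro F ⟨p, hp⟩
    refine ⟨fun {X Y f g} => ?_⟩
    -- Dually, the colimit is evaluated at the source `X`, where the injections are jointly epic.
    refine (isColimitOfPreserves ((evaluation C E).obj X) p.isColimit).hom_ext fun j => ?_
    have h : ∀ k : X ⟶ Y, (p.ι.app j).app X ≫ F.map k = (p.diag.obj j).map k ≫ (p.ι.app j).app Y :=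
      fun k => ((p.ι.app j).naturality k).symm
    have hadd : (p.diag.obj j).map (f + g) = (p.diag.obj j).map f + (p.diag.obj j).map g :=
      (show (p.diag.obj j).Additive from hp j).map_add
    change (p.ι.app j).app X ≫ F.map (f + g) = (p.ι.app j).app X ≫ (F.map f + F.map g)
    rw [h, hadd, Preadditive.add_comp, Preadditive.comp_add, h, h]

variable (E) in
/-- Precomposition of additive functors with an additive functor. -/
def precomp (F : C ⥤ D) [F.Additive] : (D ⥤+ E) ⥤ (C ⥤+ E) :=
  (additiveFunctor _ _).lift
    (AdditiveFunctor.forget _ _ ⋙ (Functor.whiskeringLeft _ _ _).obj F)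
    fun M => inferInstanceAs (F ⋙ M.obj).Additive

/-- Precomposition preserves pointwise (co)limits of all functors. Closure of additive functors
under (co)limits lets the forgetful functors preserve and reflect them. -/
theorem precomp_exact [HasFiniteLimits E] [HasFiniteColimits E] (F : C ⥤ D) [F.Additive] :
    exactFunctor _ _ (precomp E F) := by
  refine (exactFunctor_iff _).2 ⟨⟨fun J _ _ => ?_⟩, ⟨fun J _ _ => ?_⟩⟩
  · have := additiveFunctor_isClosedUnderLimitsOfShape (C := C) (E := E) J
    have := additiveFunctor_isClosedUnderLimitsOfShape (C := D) (E := E) J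
    have : PreservesLimitsOfShape J (precomp E F ⋙ AdditiveFunctor.forget C E) :=
      inferInstanceAs (PreservesLimitsOfShape J
        (AdditiveFunctor.forget D E ⋙ (Functor.whiskeringLeft _ _ _).obj F))
    exact preservesLimitsOfShape_of_reflects_of_preserves _ (AdditiveFunctor.forget C E)
  · have := additiveFunctor_isClosedUnderColimitsOfShape (C := C) (E := E) J
    have := additiveFunctor_isClosedUnderColimitsOfShape (C := D) (E := E) J
    have : PreservesColimitsOfShape J (precomp E F ⋙ AdditiveFunctor.forget C E) :=
      inferInstanceAs (PreservesColimitsOfShape J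
        (AdditiveFunctor.forget D E ⋙ (Functor.whiskeringLeft _ _ _).obj F))
    exact preservesColimitsOfShape_of_reflects_of_preserves _ (AdditiveFunctor.forget C E)

end Precomposition

theorem exactFunctor_comp {C D E : Type*} [Category* C] [Category* D] [Category* E]
    {F : C ⥤ D} {F' : D ⥤ E} (h : exactFunctor _ _ F) (h' : exactFunctor _ _ F') :
    exactFunctor _ _ (F ⋙ F') := by
  rw [exactFunctor_iff] at h h' ⊢
  obtain ⟨_, _⟩ := h
  obtain ⟨_, _⟩ := h'
  exact ⟨comp_preservesFiniteLimits _ _, comp_preservesFiniteColimits _ _⟩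

end EquivariantAlgebra

/-! ### The internal hom and its adjunction with the box product. -/

namespace EquivariantAlgebra

namespace BurnsideCat

variable {G : Type u} [Group G]

/-- The functor `Y ↦ X × Y` on the Burnside category. -/
noncomputable abbrev prodLeft (X : BurnsideCat G) : BurnsideCat G ⥤ BurnsideCat G :=
  (Functor.curry.obj (prodFunctor G)).obj X

instance (X : BurnsideCat G) : (prodLeft X).Additive where
  map_add {_ _ f g} := map_add (BurnsideHom.prod (𝟙 X : X ⟶ X)) f g

/-- The natural transformation `X × - ⟶ X' × -` induced by a morphism `X ⟶ X'`. -/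
noncomputable abbrev prodLeftMap {X X' : BurnsideCat G} (f : X ⟶ X') : prodLeft X ⟶ prodLeft X' :=
  (Functor.curry.obj (prodFunctor G)).map f

theorem prodLeftMap_add {X X' : BurnsideCat G} (f g : X ⟶ X') :
    prodLeftMap (f + g) = prodLeftMap f + prodLeftMap g := by
  ext Y
  exact DFunLike.congr_fun (map_add BurnsideHom.prod f g) (𝟙 Y : Y ⟶ Y)

theorem prodFunctor_map_eq {X X' Y Y' : BurnsideCat G} (f : X ⟶ X') (g : Y ⟶ Y') :
    (prodFunctor G).map (show (X, Y) ⟶ (X', Y') from (f, g)) =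
      (prodLeft X).map g ≫ (prodLeftMap f).app Y' := by
  refine Eq.trans ?_ ((prodFunctor G).map_comp (show (X, Y) ⟶ (X, Y') from (𝟙 X, g))
    (show (X, Y') ⟶ (X', Y') from (f, 𝟙 Y')))
  exact congrArg (prodFunctor G).map (Prod.ext (Category.id_comp f).symm (Category.comp_id g).symm)

end BurnsideCat

namespace MackeyFunctor

variable {G : Type u} [Group G]

theorem hom_ext_apply {P K : MackeyFunctor G} {f g : P ⟶ K}
    (h : ∀ (Y : BurnsideCat G) (m : P.obj.obj Y), f.hom.app Y m = g.hom.app Y m) : f = g :=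
  ObjectProperty.hom_ext _ (NatTrans.ext (funext fun Y => by ext m; exact h Y m))

theorem hom_naturality_apply {P K : MackeyFunctor G} (f : P ⟶ K) {X Y : BurnsideCat G} (g : X ⟶ Y)
    (m : P.obj.obj X) : f.hom.app Y (P.obj.map g m) = K.obj.map g (f.hom.app X m) :=
  ConcreteCategory.congr_hom (f.hom.naturality g) m

/-- The functor `X ↦ K(X × -)`, for a Mackey functor `K`. -/
noncomputable def shift (K : MackeyFunctor G) : BurnsideCat G ⥤ MackeyFunctor G where
  obj X := (precomp _ (BurnsideCat.prodLeft X)).obj K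
  map f := ObjectProperty.homMk (Functor.whiskerRight (BurnsideCat.prodLeftMap f) K.obj)
  map_id X := by
    ext1
    refine (congrArg (Functor.whiskerRight · K.obj) (CategoryTheory.Functor.map_id _ X)).trans ?_
    exact Functor.whiskerRight_id' _
  map_comp f g := by
    ext1
    refine (congrArg (Functor.whiskerRight · K.obj) (Functor.map_comp _ f g)).trans ?_
    exact Functor.whiskerRight_comp _ _ _

instance (K : MackeyFunctor G) : K.shift.Additive where
  map_add {X Y f g} := by
    ext1
    refine NatTrans.ext (funext fun Z => ?_)
    refine (congrArg (fun t => K.obj.map (NatTrans.app t Z))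
      (BurnsideCat.prodLeftMap_add f g)).trans ?_
    exact K.obj.map_add

/-- The morphism `K(X × -) ⟶ K'(X × -)` induced by a morphism `K ⟶ K'`. -/
noncomputable def shiftMap {K K' : MackeyFunctor G} (f : K ⟶ K') : K.shift ⟶ K'.shift where
  app X := (precomp _ (BurnsideCat.prodLeft X)).map f
  naturality X Y g := by
    ext1
    refine NatTrans.ext (funext fun Z => ?_)
    exact f.hom.naturality _

/-- The internal hom of Mackey functors, `X ↦ Hom(P, K(X × -))`. -/
noncomputable def internalHom (P : MackeyFunctor G) : MackeyFunctor G ⥤ MackeyFunctor G where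
  obj K := AdditiveFunctor.of (K.shift ⋙ preadditiveCoyoneda.obj (Opposite.op P))
  map f := ObjectProperty.homMk (Functor.whiskerRight (shiftMap f)
    (preadditiveCoyoneda.obj (Opposite.op P)))
  map_id K := by
    ext1
    refine NatTrans.ext (funext fun X => ?_)
    exact CategoryTheory.Functor.map_id (preadditiveCoyoneda.obj (Opposite.op P)) (K.shift.obj X)
  map_comp f g := by
    ext1
    refine NatTrans.ext (funext fun X => ?_)
    exact Functor.map_comp (preadditiveCoyoneda.obj (Opposite.op P))
      ((shiftMap f).app X) ((shiftMap g).app X)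

variable {L L' P K K' : MackeyFunctor G}

/-- The value of a morphism to the internal hom on a pair of elements. -/
noncomputable def uncurry (θ : L ⟶ (internalHom P).obj K) {X Y : BurnsideCat G} (l : L.obj.obj X)
    (m : P.obj.obj Y) : K.obj.obj ((BurnsideCat.prodFunctor G).obj (X, Y)) :=
  (show P ⟶ K.shift.obj X from θ.hom.app X l).hom.app Y m

theorem uncurry_ext {θ θ' : L ⟶ (internalHom P).obj K}
    (h : ∀ (X Y : BurnsideCat G) (l : L.obj.obj X) (m : P.obj.obj Y),
      uncurry θ l m = uncurry θ' l m) : θ = θ' :=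
  hom_ext_apply fun X l => hom_ext_apply fun Y m => h X Y l m

/-- Joint naturality splits along `(f, g) = (𝟙, g) ≫ (f, 𝟙)`: naturality of `θ` handles `f`, and
naturality of the morphism `θ(l)` handles `g`. This makes the inverse of currying natural. -/
theorem uncurry_map (θ : L ⟶ (internalHom P).obj K) {X Y X' Y' : BurnsideCat G} (f : X ⟶ X')
    (g : Y ⟶ Y') (l : L.obj.obj X) (m : P.obj.obj Y) :
    uncurry θ (L.obj.map f l) (P.obj.map g m) =
      K.obj.map ((BurnsideCat.prodFunctor G).map (show (X, Y) ⟶ (X', Y') from (f, g)))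
        (uncurry θ l m) := by
  rw [BurnsideCat.prodFunctor_map_eq, K.obj.map_comp]
  have h1 := hom_naturality_apply θ f l
  have h2 := hom_naturality_apply (show P ⟶ K.shift.obj X from θ.hom.app X l) g m
  refine (congrArg (fun t : P ⟶ K.shift.obj X' => t.hom.app Y' (P.obj.map g m)) h1).trans ?_
  exact congrArg (K.obj.map ((BurnsideCat.prodLeftMap f).app Y')) h2

theorem externalTensor_hom_ext {F : BurnsideCat G × BurnsideCat G ⥤ AddCommGrpCat.{u + 1}}
    {τ τ' : (externalTensor G).obj (L, P) ⟶ F}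
    (h : ∀ (X Y : BurnsideCat G) (l : L.obj.obj X) (m : P.obj.obj Y),
      τ.app (X, Y) (show L.obj.obj X ⊗[ℤ] P.obj.obj Y from l ⊗ₜ m) =
        τ'.app (X, Y) (show L.obj.obj X ⊗[ℤ] P.obj.obj Y from l ⊗ₜ m)) : τ = τ' := by
  refine NatTrans.ext (funext fun Z => ?_)
  refine AddCommGrpCat.hom_ext ?_
  refine AddMonoidHom.toIntLinearMap_injective ?_
  exact TensorProduct.ext' fun l m => h Z.1 Z.2 l m

/-- The currying bijection between pairings of `L` and `P` with values in `K` and morphisms from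
`L` to the internal hom. -/
noncomputable def curryEquiv (L P K : MackeyFunctor G) :
    ((externalTensor G).obj (L, P) ⟶ BurnsideCat.prodFunctor G ⋙ K.obj) ≃
      (L ⟶ (internalHom P).obj K) where
  toFun τ := ObjectProperty.homMk
    { app := fun X => AddCommGrpCat.ofHom
        { toFun := fun l => ObjectProperty.homMk
            { app := fun Y => AddCommGrpCat.ofHom
                { toFun := fun m => τ.app (X, Y) (show L.obj.obj X ⊗[ℤ] P.obj.obj Y from l ⊗ₜ m)
                  map_zero' := by rw [TensorProduct.tmul_zero]; exact map_zero _
                  map_add' := fun m m' => by rw [TensorProduct.tmul_add]; exact map_add _ _ _ }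
              naturality := fun Y Y' g => by
                ext m
                have h := ConcreteCategory.congr_hom
                  (τ.naturality (show (X, Y) ⟶ (X, Y') from (𝟙 X, g)))
                  (show L.obj.obj X ⊗[ℤ] P.obj.obj Y from l ⊗ₜ m)
                refine Eq.trans ?_ h
                -- The naturality square of `τ` acts on the fixed variable by `L.obj.map (𝟙 X)`,
                -- which must be removed.
                refine congrArg (τ.app (X, Y')) ?_
                refine congrArg (fun z : L.obj.obj X => z ⊗ₜ[ℤ] (P.obj.map g m)) ?_
                exact (ConcreteCategory.congr_hom (L.obj.map_id X) l).symm }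
          map_zero' := by
            refine hom_ext_apply fun Y m => ?_
            exact (congrArg (τ.app (X, Y)) (TensorProduct.zero_tmul _ m)).trans (map_zero _)
          map_add' := fun l l' => by
            refine hom_ext_apply fun Y m => ?_
            exact (congrArg (τ.app (X, Y)) (TensorProduct.add_tmul l l' m)).trans (map_add _ _ _) }
      naturality := fun X X' f => by
        ext l
        refine hom_ext_apply fun Y m => ?_
        have h := ConcreteCategory.congr_hom
          (τ.naturality (show (X, Y) ⟶ (X', Y) from (f, 𝟙 Y)))
          (show L.obj.obj X ⊗[ℤ] P.obj.obj Y from l ⊗ₜ m)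
        refine Eq.trans ?_ h
        refine congrArg (τ.app (X', Y)) ?_
        refine congrArg (fun z : P.obj.obj Y => (L.obj.map f l) ⊗ₜ[ℤ] z) ?_
        exact (ConcreteCategory.congr_hom (P.obj.map_id Y) m).symm }
  invFun θ :=
    { app := fun Z => AddCommGrpCat.ofHom (TensorProduct.liftAddHom
        { toFun := fun l => (show P ⟶ K.shift.obj Z.1 from θ.hom.app Z.1 l).hom.app Z.2 |>.hom
          map_zero' := by rw [map_zero]; rfl
          map_add' := fun l l' => by rw [map_add]; rfl }
        (fun r l m => by
          simp only [map_zsmul]; rfl))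
      naturality := fun Z Z' f => by
        refine AddCommGrpCat.hom_ext ?_
        refine AddMonoidHom.toIntLinearMap_injective ?_
        exact TensorProduct.ext' fun l m => uncurry_map θ f.1 f.2 l m }
  left_inv τ := externalTensor_hom_ext fun _ _ _ _ => rfl
  right_inv θ := uncurry_ext fun _ _ _ _ => rfl

theorem curryEquiv_naturality_left (f : L' ⟶ L)
    (τ : (externalTensor G).obj (L, P) ⟶ BurnsideCat.prodFunctor G ⋙ K.obj) :
    curryEquiv L' P K ((externalTensor G).map (show (L', P) ⟶ (L, P) from (f, 𝟙 P)) ≫ τ) =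
      f ≫ curryEquiv L P K τ :=
  uncurry_ext fun _ _ _ _ => rfl

theorem curryEquiv_naturality_right
    (τ : (externalTensor G).obj (L, P) ⟶ BurnsideCat.prodFunctor G ⋙ K.obj) (f : K ⟶ K') :
    curryEquiv L P K' (τ ≫ Functor.whiskerLeft (BurnsideCat.prodFunctor G) f.hom) =
      curryEquiv L P K τ ≫ (internalHom P).map f :=
  uncurry_ext fun _ _ _ _ => rfl

/-- Morphisms out of a box product are morphisms to the internal hom. -/
noncomputable def boxHomEquiv (L P K : MackeyFunctor G) :
    ((Prod.sectL (MackeyFunctor G) P ⋙ box G).obj L ⟶ K) ≃ (L ⟶ (internalHom P).obj K) :=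
  (ObjectProperty.fullyFaithfulι _).homEquiv.trans
    ((((BurnsideCat.prodFunctor G).lanAdjunction _).homEquiv _ _).trans (curryEquiv L P K))

/-- The functor `- ⊠ P` is left adjoint to the internal hom. -/
noncomputable def boxAdjunction (P : MackeyFunctor G) :
    Prod.sectL (MackeyFunctor G) P ⋙ box G ⊣ internalHom P :=
  Adjunction.mkOfHomEquiv
    { homEquiv := fun L K => boxHomEquiv L P K
      homEquiv_naturality_left_symm := fun {L' L K} f g => by
        -- Writing `g` as an image turns naturality of the inverse into naturality of the forward
        -- bijection.
        obtain ⟨σ, rfl⟩ := (boxHomEquiv L P K).surjective g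
        rw [Equiv.symm_apply_eq, Equiv.symm_apply_apply]
        refine (curryEquiv_naturality_left f _).symm.trans (congrArg (curryEquiv L' P K) ?_)
        exact (Adjunction.homEquiv_naturality_left _ _ _).symm
      homEquiv_naturality_right := fun {L K K'} f g => by
        refine Eq.trans ?_ (curryEquiv_naturality_right _ g)
        refine congrArg (curryEquiv L P K') ?_
        exact Adjunction.homEquiv_naturality_right _ _ _ }

end MackeyFunctor
end EquivariantAlgebra

namespace EquivariantAlgebra

variable {G : Type u} [Group G]

/-! ### Fixed points -/

namespace FinGSet

variable (N : Subgroup G)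

/-- A point of a `G`-set is `N`-fixed if every element of `N` fixes it. -/
def IsFixed {X : FinGSet G} (x : X) : Prop := ∀ n ∈ N, n • x = x

variable {N}

theorem IsFixed.map {X Y : FinGSet G} {x : X} (h : IsFixed N x) (f : X →[G] Y) :
    IsFixed N (f x) := fun n hn => by rw [← map_smul, h n hn]

/-- `n g x = g (g⁻¹ n g) x`, and `g⁻¹ n g` lies in `N` by normality. -/
theorem IsFixed.smul [hN : N.Normal] {X : FinGSet G} {x : X} (h : IsFixed N x) (g : G) :
    IsFixed N (g • x) := fun n hn => by
  have := h _ (hN.conj_mem n hn g⁻¹)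
  rw [inv_inv] at this
  conv_rhs => rw [← this]
  simp only [smul_smul]
  congr 1
  group

theorem isFixed_res [N.Normal] {X : FinGSet (G ⧸ N)} (x : res (QuotientGroup.mk' N) X) :
    IsFixed N x := fun n hn => by
  change (QuotientGroup.mk' N n) • (show X from x) = x
  have : QuotientGroup.mk' N n = 1 := (QuotientGroup.eq_one_iff n).2 hn
  rw [this, one_smul]

variable (N) [N.Normal]

/-- The `N`-fixed points of a finite `G`-set, with the action of `G/N`. -/
def fix (X : FinGSet G) : FinGSet (G ⧸ N) where
  carrier := {x : X // IsFixed N x}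
  action :=
    { smul := fun q x => Quotient.liftOn' q (fun g => ⟨g • x.1, x.2.smul g⟩) fun a b hab => by
        refine Subtype.ext ?_
        -- Here `a⁻¹ b ∈ N` fixes `x`, so `a x = a (a⁻¹ b) x = b x`.
        have h := x.2 _ (QuotientGroup.leftRel_apply.1 hab)
        change a • x.1 = b • x.1
        conv_lhs => rw [← h]
        rw [smul_smul, mul_inv_cancel_left]
      one_smul := fun x => Subtype.ext (one_smul G x.1)
      mul_smul := fun p q x => by
        induction p using QuotientGroup.induction_on
        induction q using QuotientGroup.induction_on
        exact Subtype.ext (mul_smul _ _ x.1) }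

/-- The map of `N`-fixed points induced by an equivariant map. -/
def fixMap {X Y : FinGSet G} (f : X →[G] Y) : fix N X →[G ⧸ N] fix N Y where
  toFun x := ⟨f x.1, x.2.map f⟩
  map_smul' q x := by
    induction q using QuotientGroup.induction_on
    exact Subtype.ext (map_smul f _ x.1)

end FinGSet

/-- The `N`-fixed points of a span. -/
def GSpan.fix (N : Subgroup G) [N.Normal] {X Y : FinGSet G} (S : GSpan X Y) :
    GSpan (FinGSet.fix N X) (FinGSet.fix N Y) where
  apex := FinGSet.fix N S.apex
  l := FinGSet.fixMap N S.l
  r := FinGSet.fixMap N S.r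

namespace SpanClass

variable (N : Subgroup G) [N.Normal] {X Y Z : FinGSet G}

/-- The `N`-fixed points of a class of spans. -/
def fix : SpanClass X Y →+ SpanClass (FinGSet.fix N X) (FinGSet.fix N Y) where
  toFun := Quotient.map (GSpan.fix N) (by
    rintro S S' ⟨i⟩
    let e : S.apex →[G] S'.apex := ⟨i.e, i.smul⟩
    let e' : S'.apex →[G] S.apex := ⟨i.e.symm, fun g s => by
      simp only [id]
      rw [Equiv.symm_apply_eq, i.smul, Equiv.apply_symm_apply]⟩
    exact ⟨⟨⟨FinGSet.fixMap N e, FinGSet.fixMap N e',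
      fun s => Subtype.ext (i.e.symm_apply_apply s.1),
      fun s => Subtype.ext (i.e.apply_symm_apply s.1)⟩,
      fun g s => map_smul (FinGSet.fixMap N e) g s,
      fun s => Subtype.ext (i.hl s.1), fun s => Subtype.ext (i.hr s.1)⟩⟩)
  map_zero' := sound ⟨⟨fun x => x.1.elim, fun x => x.elim, fun x => x.1.elim, fun x => x.elim⟩,
    fun _ x => x.1.elim, fun x => x.1.elim, fun x => x.1.elim⟩
  map_add' a b := by
    induction a using ind with | _ S
    induction b using ind with | _ T
    refine sound ⟨⟨fun p => ?_, fun p => ?_, ?_, ?_⟩, ?_, ?_, ?_⟩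
    · exact match p with
        | ⟨Sum.inl s, h⟩ => Sum.inl ⟨s, fun n hn => Sum.inl_injective (h n hn)⟩
        | ⟨Sum.inr s, h⟩ => Sum.inr ⟨s, fun n hn => Sum.inr_injective (h n hn)⟩
    · exact match p with
        | Sum.inl s => ⟨Sum.inl s.1, fun n hn => congrArg Sum.inl (s.2 n hn)⟩
        | Sum.inr s => ⟨Sum.inr s.1, fun n hn => congrArg Sum.inr (s.2 n hn)⟩
    · rintro ⟨s | s, h⟩ <;> rfl
    · rintro (s | s) <;> rfl
    · intro q
      induction q using QuotientGroup.induction_on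
      rintro ⟨s | s, h⟩ <;> rfl
    · rintro ⟨s | s, h⟩ <;> rfl
    · rintro ⟨s | s, h⟩ <;> rfl

theorem fix_id (X : FinGSet G) :
    fix N (mk (GSpan.id X)) = mk (GSpan.id (FinGSet.fix N X)) :=
  sound ⟨Equiv.refl _, fun _ _ => rfl, fun _ => rfl, fun _ => rfl⟩

/-- Fixed points commute with pullbacks: a point of a pullback is fixed exactly when both
coordinates are. -/
theorem fix_comp (a : SpanClass X Y) (b : SpanClass Y Z) :
    fix N (comp a b) = comp (fix N a) (fix N b) := by
  induction a using ind with | _ S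
  induction b using ind with | _ T
  refine sound ⟨⟨fun p => ⟨(⟨p.1.1.1, fun n hn => ?_⟩, ⟨p.1.1.2, fun n hn => ?_⟩), ?_⟩,
    fun p => ⟨⟨(p.1.1.1, p.1.2.1), ?_⟩, fun n hn => ?_⟩, fun _ => rfl, fun _ => rfl⟩,
    ?_, fun _ => rfl, fun _ => rfl⟩
  · exact congrArg (fun q => q.1.1) (p.2 n hn)
  · exact congrArg (fun q => q.1.2) (p.2 n hn)
  · exact Subtype.ext p.1.2
  · exact congrArg Subtype.val p.2
  · exact Subtype.ext (Prod.ext (p.1.1.2 n hn) (p.1.2.2 n hn))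
  · intro q p
    induction q using QuotientGroup.induction_on
    rfl

end SpanClass

namespace BurnsideHom

/-- The `N`-fixed points of a morphism of the Burnside category. -/
noncomputable def fix (N : Subgroup G) [N.Normal] {X Y : FinGSet G} :
    BurnsideHom X Y →+ BurnsideHom (FinGSet.fix N X) (FinGSet.fix N Y) :=
  groupCompletionMap (SpanClass.fix N)

theorem fix_of (N : Subgroup G) [N.Normal] {X Y : FinGSet G} (a : SpanClass X Y) :
    fix N (of a) = of (SpanClass.fix N a) := groupCompletionMap_of _ _

theorem fix_comp (N : Subgroup G) [N.Normal] {X Y Z : FinGSet G} (f : BurnsideHom X Y)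
    (g : BurnsideHom Y Z) : fix N (comp f g) = comp (fix N f) (fix N g) := by
  induction f using induction with
  | hs x y hx hy => simp only [map_sub, AddMonoidHom.sub_apply, hx, hy]
  | h a =>
    induction g using induction with
    | hs x y hx hy => simp only [map_sub, hx, hy]
    | h b => simp only [comp_of, fix_of, SpanClass.fix_comp]

end BurnsideHom

/-! ### The fixed-point functor and calculus with spans. -/

namespace BurnsideCat

/-- The functor of Burnside categories which sends a finite `G`-set to its `N`-fixed points. -/
noncomputable def fixedPoints (N : Subgroup G) [N.Normal] :
    BurnsideCat G ⥤ BurnsideCat (G ⧸ N) where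
  obj X := ⟨FinGSet.fix N X.gset⟩
  map f := BurnsideHom.fix N f
  map_id X := (BurnsideHom.fix_of N _).trans (congrArg BurnsideHom.of (SpanClass.fix_id N X.gset))
  map_comp f g := BurnsideHom.fix_comp N f g

instance (N : Subgroup G) [N.Normal] : (fixedPoints N).Additive where
  map_add {_ _ f g} := map_add (BurnsideHom.fix N) f g

/-- The morphism of the Burnside category given by a span. -/
noncomputable def ofSpan {X Y : FinGSet G} (S : GSpan X Y) :
    (⟨X⟩ : BurnsideCat G) ⟶ ⟨Y⟩ := BurnsideHom.of (SpanClass.mk S)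

theorem ofSpan_eq {X Y : FinGSet G} {S T : GSpan X Y} (i : GSpan.Iso S T) : ofSpan S = ofSpan T :=
  congrArg BurnsideHom.of (SpanClass.sound i)

theorem ofSpan_comp {X Y Z : FinGSet G} (S : GSpan X Y) (T : GSpan Y Z) :
    ofSpan S ≫ ofSpan T = ofSpan (S.comp T) := BurnsideHom.comp_of _ _

theorem ofSpan_add {X Y : FinGSet G} (S T : GSpan X Y) :
    ofSpan (S.add T) = ofSpan S + ofSpan T :=
  map_add BurnsideHom.of (SpanClass.mk S) (SpanClass.mk T)

theorem ofSpan_id (X : FinGSet G) : ofSpan (GSpan.id X) = 𝟙 (⟨X⟩ : BurnsideCat G) := rfl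

theorem prodFunctor_map_ofSpan {X Y X' Y' : FinGSet G} (S : GSpan X Y) (T : GSpan X' Y') :
    (prodFunctor G).map (show ((⟨X⟩, ⟨X'⟩) : BurnsideCat G × BurnsideCat G) ⟶ (⟨Y⟩, ⟨Y'⟩) from
      (ofSpan S, ofSpan T)) = ofSpan (S.prod T) := BurnsideHom.prod_of _ _

theorem res_map_ofSpan {Q : Type u} [Group Q] (φ : G →* Q) {X Y : FinGSet Q} (S : GSpan X Y) :
    (res φ).map (ofSpan S) = ofSpan (S.res φ) := BurnsideHom.res_of φ _

theorem fixedPoints_map_ofSpan (N : Subgroup G) [N.Normal] {X Y : FinGSet G} (S : GSpan X Y) :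
    (fixedPoints N).map (ofSpan S) = ofSpan (S.fix N) := BurnsideHom.fix_of N _

/-- Reduces identities that are additive in a morphism to single spans. -/
theorem hom_induction {X Y : BurnsideCat G} {p : (X ⟶ Y) → Prop}
    (h : ∀ S : GSpan X.gset Y.gset, p (ofSpan S)) (hs : ∀ f g, p f → p g → p (f - g))
    (f : X ⟶ Y) : p f :=
  BurnsideHom.induction (p := p)
    (fun a => SpanClass.ind (p := fun a => p (BurnsideHom.of a)) h a) hs f

/-- The covariant span of an equivariant map. -/
def graph {X Y : FinGSet G} (f : X →[G] Y) : GSpan X Y := ⟨X, MulActionHom.id G, f⟩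

/-- The contravariant span of an equivariant map. -/
def cograph {X Y : FinGSet G} (f : X →[G] Y) : GSpan Y X := ⟨X, f, MulActionHom.id G⟩

/-- The underlying equivariant map of an equivariant bijection. -/
abbrev equivHom {X Y : FinGSet G} (e : X ≃ Y) (he : ∀ (g : G) x, e (g • x) = g • e x) : X →[G] Y :=
  ⟨e, he⟩

/-- The pullback of an injection along itself is the diagonal. -/
theorem graph_comp_cograph {X Y : FinGSet G} (f : X →[G] Y) (hf : Function.Injective f) :
    ofSpan (graph f) ≫ ofSpan (cograph f) = 𝟙 _ := by
  rw [ofSpan_comp, ← ofSpan_id]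
  exact ofSpan_eq ⟨⟨fun p => p.1.1, fun x => ⟨(x, x), rfl⟩,
    fun p => Subtype.ext (Prod.ext rfl (hf p.2)), fun _ => rfl⟩, fun _ _ => rfl, fun _ => rfl,
    fun p => hf p.2⟩

/-- The resulting span is the identity when `f` is bijective; for the inclusion of the fixed points,
a geometric Mackey functor sends it to the identity. -/
theorem cograph_comp_graph {X Y : FinGSet G} (f : X →[G] Y) :
    ofSpan (cograph f) ≫ ofSpan (graph f) = ofSpan ⟨X, f, f⟩ := by
  rw [ofSpan_comp]
  exact ofSpan_eq ⟨⟨fun p => p.1.1, fun x => ⟨(x, x), rfl⟩,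
    fun p => Subtype.ext (Prod.ext rfl p.2), fun _ => rfl⟩, fun _ _ => rfl, fun _ => rfl,
    fun p => congrArg f p.2⟩

/-- The isomorphism of the Burnside category given by an equivariant bijection. -/
noncomputable def isoOfEquiv {X Y : FinGSet G} (e : X ≃ Y)
    (he : ∀ (g : G) x, e (g • x) = g • e x) : (⟨X⟩ : BurnsideCat G) ≅ ⟨Y⟩ where
  hom := ofSpan (graph (equivHom e he))
  inv := ofSpan (cograph (equivHom e he))
  hom_inv_id := graph_comp_cograph _ e.injective
  inv_hom_id := (cograph_comp_graph _).trans (ofSpan_eq (T := GSpan.id Y)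
    ⟨e, he, fun _ => rfl, fun _ => rfl⟩)

/-- Pulling back along a bijection changes nothing, so an equivariant bijection of apexes compatible
with the feet suffices for a naturality square. -/
theorem isoOfEquiv_naturality {X Y X' Y' : FinGSet G} (eX : X ≃ X')
    (hX : ∀ (g : G) x, eX (g • x) = g • eX x) (eY : Y ≃ Y')
    (hY : ∀ (g : G) x, eY (g • x) = g • eY x) (S : GSpan X Y) (T : GSpan X' Y')
    (a : S.apex ≃ T.apex) (ha : ∀ (g : G) x, a (g • x) = g • a x)
    (hl : ∀ s, T.l (a s) = eX (S.l s)) (hr : ∀ s, T.r (a s) = eY (S.r s)) :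
    ofSpan S ≫ (isoOfEquiv eY hY).hom = (isoOfEquiv eX hX).hom ≫ ofSpan T := by
  refine (ofSpan_comp _ _).trans (Eq.trans (ofSpan_eq ?_) (ofSpan_comp _ _).symm)
  exact ⟨⟨fun p => ⟨(S.l p.1.1, a p.1.1), (hl p.1.1).symm⟩,
    fun p => ⟨(a.symm p.1.2, S.r (a.symm p.1.2)), rfl⟩,
    fun p => Subtype.ext (Prod.ext (a.symm_apply_apply _)
      ((congrArg S.r (a.symm_apply_apply _)).trans p.2)),
    fun p => Subtype.ext (Prod.ext (eX.injective (by
      refine (hl _).symm.trans ?_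
      rw [a.apply_symm_apply]
      exact p.2.symm)) (a.apply_symm_apply _))⟩,
    fun g p => Subtype.ext (Prod.ext (map_smul S.l g _) (ha g _)), fun _ => rfl,
    fun p => (hr _).trans (congrArg eY p.2)⟩

/-! ### Compatibility of fixed points with `q^*` and with products. -/

variable (N : Subgroup G) [N.Normal]

/-- A finite `G/N`-set consists of the `N`-fixed points of the associated `G`-set. -/
def fixResEquiv (X : FinGSet (G ⧸ N)) :
    FinGSet.fix N (FinGSet.res (QuotientGroup.mk' N) X) ≃ X where
  toFun x := x.1
  invFun x := ⟨x, FinGSet.isFixed_res (N := N) (X := X) x⟩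

/-- Taking fixed points is left inverse to regarding `G/N`-sets as `G`-sets. -/
noncomputable def resFixedPointsIso : res (QuotientGroup.mk' N) ⋙ fixedPoints N ≅ 𝟭 _ :=
  NatIso.ofComponents
    (fun X => isoOfEquiv (fixResEquiv N X.gset) fun q x => by
      induction q using QuotientGroup.induction_on
      rfl)
    fun {X Y} f => by
      induction f using hom_induction with
      | hs f g hf hg =>
        simp only [Functor.map_sub, Preadditive.sub_comp, Preadditive.comp_sub, hf, hg]
      | h S =>
        have h : (res (QuotientGroup.mk' N) ⋙ fixedPoints N).map (ofSpan S) =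
            ofSpan ((S.res (QuotientGroup.mk' N)).fix N) :=
          (congrArg (fixedPoints N).map (res_map_ofSpan _ S)).trans (fixedPoints_map_ofSpan N _)
        rw [h]
        exact isoOfEquiv_naturality _ _ _ _ _ S (fixResEquiv N S.apex) (fun q x => by
          induction q using QuotientGroup.induction_on
          rfl) (fun _ => rfl) fun _ => rfl

/-- The fixed points of a product of a `G/N`-set and a `G`-set. -/
def fixProdEquiv (X : FinGSet (G ⧸ N)) (Y : FinGSet G) :
    FinGSet.fix N ((FinGSet.res (QuotientGroup.mk' N) X).prod Y) ≃ X.prod (FinGSet.fix N Y) where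
  toFun p := (p.1.1, ⟨p.1.2, fun n hn => congrArg Prod.snd (p.2 n hn)⟩)
  invFun p := ⟨(p.1, p.2.1), fun n hn => Prod.ext (FinGSet.isFixed_res (N := N) (X := X) p.1 n hn)
    (p.2.2 n hn)⟩

/-- Fixed points of the product of a `G/N`-set `X` and a `G`-set `Y` are the product of `X` and the
fixed points of `Y`. -/
noncomputable def prodFixedPointsIso :
    (res (QuotientGroup.mk' N)).prod (𝟭 _) ⋙ prodFunctor G ⋙ fixedPoints N ≅
      (𝟭 _).prod (fixedPoints N) ⋙ prodFunctor (G ⧸ N) :=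
  NatIso.ofComponents
    (fun X => isoOfEquiv (fixProdEquiv N X.1.gset X.2.gset) fun q x => by
      induction q using QuotientGroup.induction_on
      rfl)
    fun {X Y} f => by
      obtain ⟨f, g⟩ := f
      let e (X : BurnsideCat (G ⧸ N) × BurnsideCat G) :=
        isoOfEquiv (fixProdEquiv N X.1.gset X.2.gset) fun q x => by
          induction q using QuotientGroup.induction_on
          rfl
      -- In this form both sides are additive in `f` and in `g` separately, which reduces the square
      -- to a pair of spans.
      change BurnsideHom.comp (BurnsideHom.fix N (BurnsideHom.prod (BurnsideHom.res _ f) g))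
        (e Y).hom = BurnsideHom.comp (e X).hom (BurnsideHom.prod f (BurnsideHom.fix N g))
      induction f using hom_induction with
      | hs f f' hf hf' =>
        erw [map_sub, map_sub]
        simp only [map_sub, AddMonoidHom.sub_apply, hf, hf']
      | h S =>
        induction g using hom_induction with
        | hs g g' hg hg' =>
          erw [map_sub, map_sub]
          simp only [map_sub, AddMonoidHom.sub_apply, hg, hg']
        | h T =>
          have h1 : BurnsideHom.fix N (BurnsideHom.prod
              (BurnsideHom.res (QuotientGroup.mk' N) (ofSpan S)) (ofSpan T)) =
              ofSpan (((S.res (QuotientGroup.mk' N)).prod T).fix N) := by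
            refine Eq.trans ?_ (fixedPoints_map_ofSpan N _)
            refine congrArg (BurnsideHom.fix N) ?_
            exact (congrArg (fun t => BurnsideHom.prod t (ofSpan T)) (res_map_ofSpan _ S)).trans
              (prodFunctor_map_ofSpan _ _)
          have h2 : BurnsideHom.prod (ofSpan S) (BurnsideHom.fix N (ofSpan T)) =
              ofSpan (S.prod (T.fix N)) :=
            (congrArg (BurnsideHom.prod (ofSpan S)) (fixedPoints_map_ofSpan N T)).trans
              (prodFunctor_map_ofSpan _ _)
          rw [h1, h2]
          exact isoOfEquiv_naturality _ _ _ _ _ _ (fixProdEquiv N S.apex T.apex)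
            (fun q x => by
              induction q using QuotientGroup.induction_on
              rfl) (fun _ => rfl) fun _ => rfl

/-- Taking the product with a point changes nothing. -/
noncomputable def pointProdIso (G : Type u) [Group G] :
    prodLeft (⟨FinGSet.point G⟩ : BurnsideCat G) ≅ 𝟭 _ :=
  NatIso.ofComponents
    (fun X => isoOfEquiv (X := (FinGSet.point G).prod X.gset) (Equiv.punitProd _) fun _ _ => rfl)
    fun {X Y} f => by
      induction f using hom_induction with
      | hs f g hf hg =>
        simp only [Functor.map_sub, Preadditive.sub_comp, Preadditive.comp_sub, hf, hg]
      | h S =>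
        refine (congrArg (· ≫ _) (prodFunctor_map_ofSpan (GSpan.id _) S)).trans ?_
        exact isoOfEquiv_naturality _ _ _ _ _ S (Equiv.punitProd _) (fun _ _ => rfl) (fun _ => rfl)
          fun _ => rfl

end BurnsideCat
end EquivariantAlgebra

/-! ### Geometric Mackey functors and their equivalence with `G/N`-Mackey functors. -/

namespace EquivariantAlgebra

variable {G : Type u} [Group G]

namespace FinGSet

/-- The complement of the image of an equivariant map. -/
def compl {X Y : FinGSet G} (f : X →[G] Y) : FinGSet G where
  carrier := {y : Y // y ∉ Set.range f}
  action :=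
    { smul := fun g y => ⟨g • y.1, fun ⟨x, hx⟩ => y.2 ⟨g⁻¹ • x, by
        rw [map_smul, hx, inv_smul_smul]⟩⟩
      one_smul := fun y => Subtype.ext (one_smul G y.1)
      mul_smul := fun g h y => Subtype.ext (mul_smul g h y.1) }

end FinGSet

namespace GSpan

/-- The restriction of a span along an equivariant map to its apex. -/
def restrict {X Y A : FinGSet G} (S : GSpan X Y) (f : A →[G] S.apex) : GSpan X Y :=
  ⟨A, S.l.comp f, S.r.comp f⟩

/-- The restriction of a span to the complement of the image of an equivariant map. -/
def compl {X Y A : FinGSet G} (S : GSpan X Y) (f : A →[G] S.apex) : GSpan X Y :=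
  S.restrict (A := FinGSet.compl f) ⟨Subtype.val, fun _ _ => rfl⟩

open Classical in
/-- A span is the disjoint union of its restriction along an injective map and the complement. -/
noncomputable def addComplIso {X Y A : FinGSet G} (S : GSpan X Y) (f : A →[G] S.apex)
    (hf : Function.Injective f) : Iso ((S.restrict f).add (S.compl f)) S where
  e := ((Equiv.ofInjective f hf).sumCongr (Equiv.refl _)).trans (Equiv.Set.sumCompl (Set.range f))
  smul := by
    rintro g (s | s)
    · exact map_smul f g s
    · rfl
  hl := by rintro (s | s) <;> rfl
  hr := by rintro (s | s) <;> rfl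

end GSpan

namespace MackeyFunctor

open BurnsideCat

variable (N : Subgroup G)

/-- A Mackey functor is `N`-geometric if it vanishes on the `G`-sets without `N`-fixed points. -/
def geometric : ObjectProperty (MackeyFunctor G) := fun K =>
  ∀ X : FinGSet G, (∀ x : X, ¬ FinGSet.IsFixed N x) → ∀ m : K.obj.obj ⟨X⟩, m = 0

variable {N} {K : MackeyFunctor G} (hK : geometric N K)

include hK

/-- A span is restriction to its apex followed by transfer, so its action factors through `K(S.apex)
= 0`. -/
theorem geometric.map_eq_zero {X Y : FinGSet G} (S : GSpan X Y)
    (hS : ∀ s : S.apex, ¬ FinGSet.IsFixed N s) : K.obj.map (ofSpan S) = 0 := by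
  have h : ofSpan S = ofSpan (cograph S.l) ≫ ofSpan (graph S.r) := by
    rw [ofSpan_comp]
    exact ofSpan_eq ⟨⟨fun s => ⟨(s, s), rfl⟩, fun p => p.1.1, fun _ => rfl,
      fun p => Subtype.ext (Prod.ext rfl p.2)⟩, fun _ _ => rfl, fun _ => rfl, fun _ => rfl⟩
  rw [h, K.obj.map_comp]
  ext m
  change K.obj.map (ofSpan (graph S.r)) (K.obj.map (ofSpan (cograph S.l)) m) = 0
  rw [hK S.apex hS (K.obj.map (ofSpan (cograph S.l)) m), map_zero]

/-- A geometric Mackey functor only sees the fixed points of a span. -/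
theorem geometric.map_restrict {X Y A : FinGSet G} (S : GSpan X Y) (f : A →[G] S.apex)
    (hf : Function.Injective f) (h : ∀ s : S.apex, FinGSet.IsFixed N s → s ∈ Set.range f) :
    K.obj.map (ofSpan (S.restrict f)) = K.obj.map (ofSpan S) := by
  -- All fixed points lie in the range of `f`, so the complementary summand acts as zero.
  rw [← ofSpan_eq (S.addComplIso f hf), ofSpan_add, Functor.map_add,
    hK.map_eq_zero (S.compl f) (fun s hs => s.2 (h _ fun n hn => congrArg Subtype.val (hs n hn))),
    add_zero]

omit hK

variable (N) [N.Normal]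

/-- The inclusion of the fixed points of a `G`-set. -/
def fixIncl (X : FinGSet G) :
    FinGSet.res (QuotientGroup.mk' N) (FinGSet.fix N X) →[G] X :=
  ⟨Subtype.val, fun _ _ => rfl⟩

/-- Restriction to the fixed points, as a morphism of the Burnside category. -/
noncomputable def toFix (X : BurnsideCat G) :
    X ⟶ (fixedPoints N ⋙ BurnsideCat.res (QuotientGroup.mk' N)).obj X :=
  ofSpan (cograph (fixIncl N X.gset))

/-- Transfer from the fixed points, as a morphism of the Burnside category. -/
noncomputable def ofFix (X : BurnsideCat G) :
    (fixedPoints N ⋙ BurnsideCat.res (QuotientGroup.mk' N)).obj X ⟶ X :=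
  ofSpan (graph (fixIncl N X.gset))

/-- On geometric Mackey functors, restriction to the fixed points is natural in the Burnside
category. -/
theorem geometric.map_toFix_naturality (hK : geometric N K) {X Y : BurnsideCat G} (f : X ⟶ Y) :
    K.obj.map f ≫ K.obj.map (toFix N Y) =
      K.obj.map (toFix N X) ≫
        K.obj.map ((fixedPoints N ⋙ BurnsideCat.res (QuotientGroup.mk' N)).map f) := by
  induction f using hom_induction with
  | hs f g hf hg =>
    rw [Functor.map_sub, Functor.map_sub, Functor.map_sub, Preadditive.sub_comp,
      Preadditive.comp_sub, hf, hg]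
  | h S =>
    have h : (fixedPoints N ⋙ BurnsideCat.res (QuotientGroup.mk' N)).map (ofSpan S) =
        ofSpan ((S.fix N).res (QuotientGroup.mk' N)) :=
      (congrArg (BurnsideCat.res _).map (fixedPoints_map_ofSpan N S)).trans (res_map_ofSpan _ _)
    rw [h]
    refine (K.obj.map_comp _ _).symm.trans (Eq.trans ?_ (K.obj.map_comp _ _))
    have h1 := ofSpan_comp S (cograph (fixIncl N Y.gset))
    have h2 := ofSpan_comp (cograph (fixIncl N X.gset)) ((S.fix N).res (QuotientGroup.mk' N))
    refine (congrArg K.obj.map h1).trans (Eq.trans ?_ (congrArg K.obj.map h2).symm)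
    -- The apex of `T` is the part of `S.apex` over the fixed points of `Y`. It may exceed the fixed
    -- points of `S.apex`, but has the same fixed points; `i` embeds them and `K` ignores the rest.
    let T := S.comp (cograph (fixIncl N Y.gset))
    let i : FinGSet.res (QuotientGroup.mk' N) (FinGSet.fix N S.apex) →[G] T.apex :=
      ⟨fun s => ⟨(s.1, ⟨S.r s.1, s.2.map S.r⟩), rfl⟩, fun g s =>
        Subtype.ext (Prod.ext rfl (Subtype.ext (map_smul S.r g s.1)))⟩
    refine (hK.map_restrict T i ?_ ?_).symm.trans (congrArg K.obj.map (ofSpan_eq ?_))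
    · intro s t h
      exact Subtype.ext (congrArg (fun p => p.1.1) h)
    · rintro ⟨⟨s, y⟩, h⟩ hs
      exact ⟨⟨s, fun n hn => congrArg (fun p => p.1.1) (hs n hn)⟩,
        Subtype.ext (Prod.ext rfl (Subtype.ext h))⟩
    · exact ⟨⟨fun s => ⟨(⟨S.l s.1, s.2.map S.l⟩, s), rfl⟩, fun p => p.1.2, fun _ => rfl,
        fun p => Subtype.ext (Prod.ext p.2.symm rfl)⟩,
        fun g s => Subtype.ext (Prod.ext (Subtype.ext (map_smul S.l g s.1)) rfl),
        fun _ => rfl, fun _ => rfl⟩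

/-- A geometric Mackey functor is determined by its values on fixed points. -/
noncomputable def geometric.iso (hK : geometric N K) :
    K.obj ≅ (fixedPoints N ⋙ BurnsideCat.res (QuotientGroup.mk' N)) ⋙ K.obj :=
  NatIso.ofComponents
    (fun X =>
      { hom := K.obj.map (toFix N X)
        inv := K.obj.map (ofFix N X)
        hom_inv_id := by
          refine (K.obj.map_comp _ _).symm.trans ((congrArg K.obj.map
            (cograph_comp_graph (fixIncl N X.gset))).trans ?_)
          -- Transfer after restriction is the identity span cut down to the fixed points, which `K`
          -- cannot tell from the identity.
          refine (hK.map_restrict (GSpan.id X.gset) (fixIncl N X.gset) Subtype.val_injective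
            fun s hs => ⟨⟨s, hs⟩, rfl⟩).trans ?_
          exact K.obj.map_id X
        inv_hom_id := by
          refine (K.obj.map_comp _ _).symm.trans ((congrArg K.obj.map
            (graph_comp_cograph (fixIncl N X.gset)
            Subtype.val_injective)).trans ?_)
          exact K.obj.map_id _ })
    fun f => hK.map_toFix_naturality N f

/-- The inflation of a `G/N`-Mackey functor `L` to the `G`-Mackey functor `X ↦ L(X^N)`. -/
noncomputable def inflation : MackeyFunctor (G ⧸ N) ⥤ MackeyFunctor G :=
  precomp _ (fixedPoints N)

theorem burnsideCat_id_eq_zero {X : FinGSet G} (hX : IsEmpty X) :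
    𝟙 (⟨X⟩ : BurnsideCat G) = 0 := by
  refine Eq.trans (ofSpan_eq (T := GSpan.zero X X) ?_) (map_zero BurnsideHom.of)
  exact ⟨⟨fun x => hX.elim x, fun x => x.elim, fun x => hX.elim x, fun x => x.elim⟩,
    fun _ x => hX.elim x, fun x => hX.elim x, fun x => hX.elim x⟩

theorem eq_zero_of_isEmpty (K : MackeyFunctor G) {X : FinGSet G} (hX : IsEmpty X)
    (m : K.obj.obj ⟨X⟩) : m = 0 := by
  have h := ConcreteCategory.congr_hom (K.obj.map_id ⟨X⟩) m
  rw [burnsideCat_id_eq_zero hX, Functor.map_zero] at h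
  exact h.symm

/-- If `X` has no fixed points, `L` is evaluated at the empty set, where additivity forces zero. -/
theorem geometric_inflation (L : MackeyFunctor (G ⧸ N)) : geometric N ((inflation N).obj L) :=
  fun X hX m => eq_zero_of_isEmpty L (X := FinGSet.fix N X) ⟨fun x => hX x.1 x.2⟩ m

/-- Geometric `G`-Mackey functors are equivalent to `G/N`-Mackey functors. -/
noncomputable def geometricEquivalence :
    (geometric N).FullSubcategory ≌ MackeyFunctor (G ⧸ N) :=
  CategoryTheory.Equivalence.mk ((geometric N).ι ⋙ qLowerStar N)
    ((geometric N).lift (inflation N) (geometric_inflation N))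
    (NatIso.ofComponents
      -- Only the unit needs `K` geometric; the counit comes from an isomorphism of Burnside
      -- categories' functors and exists for every `L`.
      (fun K => (geometric N).isoMk ((additiveFunctor _ _).isoMk (geometric.iso N K.property)))
      fun {K K'} f => by
        refine ObjectProperty.hom_ext _ (ObjectProperty.hom_ext _ ?_)
        refine NatTrans.ext (funext fun X => ?_)
        exact (f.hom.hom.naturality _).symm)
    (NatIso.ofComponents
      (fun L => (additiveFunctor _ _).isoMk
        (Functor.isoWhiskerRight (resFixedPointsIso N) L.obj))
      fun {L L'} f => by
        refine ObjectProperty.hom_ext _ (NatTrans.ext (funext fun X => ?_))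
        exact (f.hom.naturality _).symm)

end MackeyFunctor
end EquivariantAlgebra

/-! ### Geometric functors under the box product, and the universal property of `ẼF_N`. -/

namespace EquivariantAlgebra

variable {G : Type u} [Group G]

namespace MackeyFunctor

open BurnsideCat

variable {N : Subgroup G}

/-- A fixed point of `X × Y` projects to one of `X`, so `W(X × -)` vanishes when `X` has none. -/
theorem geometric_internalHom (M : MackeyFunctor G) {W : MackeyFunctor G} (hW : geometric N W) :
    geometric N ((internalHom M).obj W) := fun X hX f =>
  hom_ext_apply (f := (show M ⟶ W.shift.obj ⟨X⟩ from f)) (g := 0) fun Y _ =>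
    hW (X.prod Y.gset) (fun p hp => hX p.1 fun n hn => congrArg Prod.fst (hp n hn)) _

/-- The value at `Z` is a colimit of groups `P(X) ⊗ M(Y)` over morphisms `X × Y ⟶ Z`. For a span
with apex `A`, the map to the colimit factors through `P(A) ⊗ M(A)`; `A` maps to `Z`, so it has no
fixed points and `P(A) = 0`. -/
theorem geometric_box {P : MackeyFunctor G} (hP : geometric N P) (M : MackeyFunctor G) :
    geometric N ((box G).obj (P, M)) := by
  intro Z hZ
  set p := BurnsideCat.prodFunctor G
  set E := (externalTensor G).obj (P, M)
  let L := p.lan.obj E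
  let v : E ⟶ p ⋙ L := p.lanUnit.app E
  have hv : (Functor.LeftExtension.mk L v).IsPointwiseLeftKanExtension :=
    Functor.isPointwiseLeftKanExtensionOfIsLeftKanExtension L v
  have hL : L.Additive := additive_lan (P, M)
  have key : ∀ {X Y : BurnsideCat G} (f : p.obj (X, Y) ⟶ ⟨Z⟩), v.app (X, Y) ≫ L.map f = 0 := by
    intro X Y f
    induction f using hom_induction with
    | hs f g hf hg => rw [Functor.map_sub, Preadditive.comp_sub, hf, hg, sub_zero]
    | h S =>
      let lX : S.apex →[G] X.gset :=
        ⟨fun s => (S.l s).1, fun g s => congrArg Prod.fst (map_smul S.l g s)⟩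
      let lY : S.apex →[G] Y.gset :=
        ⟨fun s => (S.l s).2, fun g s => congrArg Prod.snd (map_smul S.l g s)⟩
      -- The left leg of `T` is the diagonal: restricting to `A × A` and then along it recovers the
      -- left leg of `S`.
      let T : GSpan (S.apex.prod S.apex) Z :=
        ⟨S.apex, ⟨fun s => (s, s), fun _ _ => rfl⟩, S.r⟩
      let k : (X, Y) ⟶ ((⟨S.apex⟩, ⟨S.apex⟩) : BurnsideCat G × BurnsideCat G) :=
        (ofSpan (cograph lX), ofSpan (cograph lY))
      have h : ofSpan S = p.map k ≫ ofSpan T := by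
        refine Eq.trans ?_ (congrArg (· ≫ ofSpan T) (prodFunctor_map_ofSpan _ _)).symm
        refine Eq.trans ?_ (ofSpan_comp _ _).symm
        exact ofSpan_eq ⟨⟨fun s => ⟨((s, s), s), rfl⟩, fun q => q.1.2, fun _ => rfl,
          fun q => Subtype.ext (Prod.ext q.2.symm rfl)⟩, fun _ _ => rfl, fun _ => rfl, fun _ => rfl⟩
      have hE : E.map k = 0 := by
        refine AddCommGrpCat.hom_ext (AddMonoidHom.toIntLinearMap_injective ?_)
        refine TensorProduct.ext' fun l m => ?_
        refine Eq.trans ?_ (TensorProduct.zero_tmul _ (M.obj.map k.2 m))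
        refine congrArg (fun t : P.obj.obj ⟨S.apex⟩ => t ⊗ₜ[ℤ] (M.obj.map k.2 m)) ?_
        exact hP S.apex (fun s hs => hZ _ (hs.map S.r)) _
      have hn := v.naturality k
      rw [h]
      refine (congrArg (v.app (X, Y) ≫ ·) (L.map_comp _ _)).trans ?_
      refine (Category.assoc _ _ _).symm.trans ?_
      refine (congrArg (· ≫ L.map (ofSpan T)) hn.symm).trans ?_
      rw [hE, zero_comp]
      exact zero_comp
  -- All colimit injections vanish, so the identity of the colimit does.
  have h0 : 𝟙 (L.obj ⟨Z⟩) = 0 := (hv ⟨Z⟩).hom_ext fun j => by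
    refine (Category.comp_id _).trans (Eq.trans ?_ comp_zero.symm)
    exact key j.hom
  exact fun m => ConcreteCategory.congr_hom h0 m

section TildeE

variable [Finite G]

variable (N) in
-- Induction on the size of the apex, splitting off the orbit of a point `s`. Since `s` is not
-- fixed, its stabilizer does not contain `N`, so the orbit contributes a generator.
theorem ofSpan_mem_generatedBy {X : FinGSet G} (n : ℕ) :
    ∀ S : GSpan (FinGSet.point G) X, Nat.card S.apex = n →
      (∀ s : S.apex, ¬ FinGSet.IsFixed N s) →
      (show (burnside G).obj.obj ⟨X⟩ from ofSpan S) ∈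
        generatedBy (burnside G) {H | ¬ N ≤ H} ⟨X⟩ := by
  induction n using Nat.strong_induction_on with
  | _ n ih =>
    intro S hn hS
    rcases isEmpty_or_nonempty S.apex with hE | ⟨⟨s⟩⟩
    · have h : ofSpan S = 0 := by
        refine Eq.trans (ofSpan_eq (T := GSpan.zero _ _) ?_) (map_zero BurnsideHom.of)
        exact ⟨⟨fun x => hE.elim x, fun x => x.elim, fun x => hE.elim x, fun x => x.elim⟩,
          fun _ x => hE.elim x, fun x => hE.elim x, fun x => hE.elim x⟩
      rw [h]
      exact zero_mem _
    · let H := MulAction.stabilizer G s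
      let f : FinGSet.orbit H →[G] S.apex :=
        ⟨MulAction.ofQuotientStabilizer G s, fun g q => MulAction.ofQuotientStabilizer_smul G s g q⟩
      have hf : Function.Injective f := MulAction.injective_ofQuotientStabilizer G s
      have h : ofSpan S = ofSpan (S.restrict f) + ofSpan (S.compl f) := by
        rw [← ofSpan_add]
        exact (ofSpan_eq (S.addComplIso f hf)).symm
      rw [h]
      refine add_mem ?_ (ih _ ?_ (S.compl f) rfl ?_)
      -- The orbit summand is the transfer along `S.r ∘ f` of the class of `* ← G/H = G/H`.
      · refine AddSubgroup.subset_closure ⟨H, fun hN => hS s fun n hn => hN hn,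
          ofSpan (graph (S.r.comp f)),
          ofSpan (⟨FinGSet.orbit H, S.l.comp f, MulActionHom.id G⟩ :
            GSpan (FinGSet.point G) (FinGSet.orbit H)), ?_⟩
        refine (ofSpan_comp _ _).trans (ofSpan_eq ?_)
        exact ⟨⟨fun p => p.1.1, fun x => ⟨(x, x), rfl⟩,
          fun p => Subtype.ext (Prod.ext rfl p.2), fun _ => rfl⟩, fun _ _ => rfl, fun _ => rfl,
          fun p => congrArg (S.r.comp f) p.2⟩
      · rw [← hn]
        refine Finite.card_subtype_lt (x := s) ?_
        intro hs
        exact hs ⟨((1 : G) : G ⧸ H), one_smul G _⟩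
      · exact fun t ht => hS t.1 fun n hn => congrArg Subtype.val (ht n hn)

variable (N)

/-- A span ending in a set without fixed points has an apex without fixed points. -/
theorem geometric_tildeE : geometric N (tildeE N) := by
  intro X hX m
  induction m using QuotientAddGroup.induction_on with
  | H a =>
    refine (QuotientAddGroup.eq_zero_iff _).2 ?_
    revert a
    change ∀ a : (⟨FinGSet.point G⟩ : BurnsideCat G) ⟶ ⟨X⟩, _
    intro a
    induction a using hom_induction with
    | h S => exact ofSpan_mem_generatedBy N _ S rfl fun s hs => hX _ (hs.map S.r)
    | hs f g hf hg => exact sub_mem hf hg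

/-- The unit element of `ẼF_N`. -/
noncomputable def tildeEOne : (tildeE N).obj.obj ⟨FinGSet.point G⟩ :=
  QuotientAddGroup.mk (show (burnside G).obj.obj ⟨FinGSet.point G⟩ from
    𝟙 (⟨FinGSet.point G⟩ : BurnsideCat G))

variable [N.Normal]

/-- If `gH` is fixed, applying `g n g⁻¹ ∈ N` to it gives `gnH = gH`, so `n ∈ H`. -/
theorem not_isFixed_orbit {H : Subgroup G} (hH : ¬ N ≤ H) (x : FinGSet.orbit H) :
    ¬ FinGSet.IsFixed N x := by
  intro hx
  obtain ⟨g, rfl⟩ := QuotientGroup.mk_surjective (s := H) x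
  refine hH fun n hn => ?_
  have h := hx _ (‹N.Normal›.conj_mem n hn g)
  have h' : ((g * n * g⁻¹ * g : G) : G ⧸ H) = (g : G ⧸ H) := h
  rw [inv_mul_cancel_right, eq_comm, QuotientGroup.eq, inv_mul_cancel_left] at h'
  exact h'

/-- The morphism from `ẼF_N` to a geometric Mackey functor determined by the image of the unit. -/
noncomputable def tildeELift {W : MackeyFunctor G} (hW : geometric N W)
    (w : W.obj.obj ⟨FinGSet.point G⟩) : tildeE N ⟶ W :=
  ObjectProperty.homMk
    { app := fun X => AddCommGrpCat.ofHom (QuotientAddGroup.lift _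
        { toFun := fun a => W.obj.map (show (⟨FinGSet.point G⟩ : BurnsideCat G) ⟶ X from a) w
          map_zero' := ConcreteCategory.congr_hom (W.obj.map_zero _ X) w
          map_add' := fun a b => ConcreteCategory.congr_hom (W.obj.map_add
            (f := (show (⟨FinGSet.point G⟩ : BurnsideCat G) ⟶ X from a)) (g := b)) w }
        -- The Yoneda map kills each generator because it factors through `W(G/H) = 0`.
        ((AddSubgroup.closure_le _).2 (by
          rintro _ ⟨H, hH, f, a, rfl⟩
          refine (ConcreteCategory.congr_hom (W.obj.map_comp
            (show (⟨FinGSet.point G⟩ : BurnsideCat G) ⟶ _ from a) f) w).trans ?_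
          refine (congrArg (W.obj.map f) (hW _ (not_isFixed_orbit N hH) _)).trans (map_zero _))))
      naturality := fun X Y f => by
        ext m
        induction m using QuotientAddGroup.induction_on with
        | H a =>
          exact ConcreteCategory.congr_hom (W.obj.map_comp
            (show (⟨FinGSet.point G⟩ : BurnsideCat G) ⟶ _ from a) f) w }

/-- Yoneda: `ẼF_N` is generated by its unit, which gives injectivity, and a geometric target
satisfies the relations of the quotient, which gives surjectivity. -/
theorem tildeE_bijective {W : MackeyFunctor G} (hW : geometric N W) :
    Function.Bijective fun f : tildeE N ⟶ W => f.hom.app ⟨FinGSet.point G⟩ (tildeEOne N) := by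
  refine ⟨fun f g h => hom_ext_apply fun X m => ?_, fun w => ⟨tildeELift N hW w,
    ConcreteCategory.congr_hom (W.obj.map_id _) w⟩⟩
  induction m using QuotientAddGroup.induction_on with
  | H a =>
    let a' : (⟨FinGSet.point G⟩ : BurnsideCat G) ⟶ X := a
    have ha : (tildeE N).obj.map a' (tildeEOne N) = QuotientAddGroup.mk a :=
      congrArg QuotientAddGroup.mk (Category.id_comp a')
    have hf := hom_naturality_apply f a' (tildeEOne N)
    have hg := hom_naturality_apply g a' (tildeEOne N)
    rw [ha] at hf hg
    exact hf.trans ((congrArg (W.obj.map a') h).trans hg.symm)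

end TildeE

end MackeyFunctor
end EquivariantAlgebra

/-! ### The adjunction of `Φ^N` with inflation, the projection formula and flatness. -/

namespace EquivariantAlgebra

variable {G : Type u} [Group G]

namespace MackeyFunctor

open BurnsideCat

/-- Evaluation of a shifted Mackey functor at the point. -/
noncomputable def shiftPointIso (W : MackeyFunctor G) : W.shift.obj ⟨FinGSet.point G⟩ ≅ W :=
  (additiveFunctor _ _).isoMk (Functor.isoWhiskerRight (pointProdIso G) W.obj)

theorem shiftPointIso_naturality {W W' : MackeyFunctor G} (h : W ⟶ W') :
    (shiftMap h).app ⟨FinGSet.point G⟩ ≫ (shiftPointIso W').hom = (shiftPointIso W).hom ≫ h := by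
  refine hom_ext_apply fun X m => ?_
  exact (hom_naturality_apply h ((pointProdIso G).hom.app X) m).symm

variable [Finite G] (N : Subgroup G) [N.Normal] (M : MackeyFunctor G)

/-- A morphism from `ẼF_N ⊠ M` restricts to a morphism from `M` along the unit of `ẼF_N`. -/
noncomputable def restrictUnit {W : MackeyFunctor G} (f : (box G).obj (tildeE N, M) ⟶ W) : M ⟶ W :=
  (show M ⟶ W.shift.obj ⟨FinGSet.point G⟩ from
    ((boxAdjunction M).homEquiv (tildeE N) W f).hom.app ⟨FinGSet.point G⟩ (tildeEOne N)) ≫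
    (shiftPointIso W).hom

/-- `Hom(ẼF_N ⊠ M, W) ≅ Hom(ẼF_N, [M, W]) ≅ [M, W](*) ≅ Hom(M, W)`, with `[M, W]` the internal hom;
the middle step uses that it is geometric. -/
theorem restrictUnit_bijective {W : MackeyFunctor G} (hW : geometric N W) :
    Function.Bijective (restrictUnit N M (W := W)) := by
  have h1 := ((boxAdjunction M).homEquiv (tildeE N) W).bijective
  have h2 := tildeE_bijective N (geometric_internalHom M hW)
  have h3 : Function.Bijective fun f : M ⟶ W.shift.obj ⟨FinGSet.point G⟩ =>
      f ≫ (shiftPointIso W).hom :=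
    ⟨fun f g h => (cancel_mono _).1 h, fun g => ⟨g ≫ (shiftPointIso W).inv, by simp⟩⟩
  exact h3.comp (h2.comp h1)

omit [N.Normal] in
theorem restrictUnit_comp {W W' : MackeyFunctor G} (f : (box G).obj (tildeE N, M) ⟶ W)
    (h : W ⟶ W') : restrictUnit N M (f ≫ h) = restrictUnit N M f ≫ h := by
  have h1 := (boxAdjunction M).homEquiv_naturality_right f h
  have h2 : restrictUnit N M (f ≫ h) = (show M ⟶ W.shift.obj ⟨FinGSet.point G⟩ from
      ((boxAdjunction M).homEquiv (tildeE N) W f).hom.app ⟨FinGSet.point G⟩ (tildeEOne N)) ≫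
      (shiftMap h).app ⟨FinGSet.point G⟩ ≫ (shiftPointIso W').hom :=
    (congrArg (fun t : tildeE N ⟶ (internalHom M).obj W' =>
      (show M ⟶ W'.shift.obj ⟨FinGSet.point G⟩ from
        t.hom.app ⟨FinGSet.point G⟩ (tildeEOne N)) ≫ (shiftPointIso W').hom) h1).trans
      (Category.assoc _ _ _)
  rw [h2, shiftPointIso_naturality]
  exact (Category.assoc _ _ _).symm

/-- The adjunction between geometric fixed points and inflation, on morphisms. -/
noncomputable def toInflation {K : MackeyFunctor (G ⧸ N)}
    (f : (geometricFixedPoints N).obj M ⟶ K) : M ⟶ (inflation N).obj K :=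
  restrictUnit N M (((geometricEquivalence N).toAdjunction.homEquiv
    ⟨(box G).obj (tildeE N, M), geometric_box (geometric_tildeE N) M⟩ K f).hom)

/-- Reflection onto geometric functors followed by the equivalence `q_*` is left adjoint to
inflation. -/
theorem toInflation_bijective (K : MackeyFunctor (G ⧸ N)) :
    Function.Bijective (toInflation N M (K := K)) :=
  (restrictUnit_bijective N M (geometric_inflation N K)).comp
    ((geometric N).fullyFaithfulι.homEquiv.bijective.comp
      ((geometricEquivalence N).toAdjunction.homEquiv
        ⟨(box G).obj (tildeE N, M), geometric_box (geometric_tildeE N) M⟩ K).bijective)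

theorem toInflation_comp {K K' : MackeyFunctor (G ⧸ N)}
    (f : (geometricFixedPoints N).obj M ⟶ K) (h : K ⟶ K') :
    toInflation N M (f ≫ h) = toInflation N M f ≫ (inflation N).map h := by
  have h1 := congrArg (fun t : (⟨(box G).obj (tildeE N, M),
      geometric_box (geometric_tildeE N) M⟩ : (geometric N).FullSubcategory) ⟶
        (geometricEquivalence N).inverse.obj K' => restrictUnit N M t.hom)
    ((geometricEquivalence N).toAdjunction.homEquiv_naturality_right
      (X := ⟨(box G).obj (tildeE N, M), geometric_box (geometric_tildeE N) M⟩) f h)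
  exact h1.trans (restrictUnit_comp N M _ _)

/-- By naturality the map is `f ↦ toInflation (𝟙) ≫ inflation f`, and inflation is additive on
morphisms. -/
theorem toInflation_add {K : MackeyFunctor (G ⧸ N)}
    (f g : (geometricFixedPoints N).obj M ⟶ K) :
    toInflation N M (f + g) = toInflation N M f + toInflation N M g := by
  have h : ∀ f : (geometricFixedPoints N).obj M ⟶ K,
      toInflation N M f = toInflation N M (𝟙 _) ≫ (inflation N).map f := fun f => by
    rw [← toInflation_comp, Category.id_comp]
  rw [h, h f, h g, ← Preadditive.comp_add]
  rfl

theorem toInflation_zero (K : MackeyFunctor (G ⧸ N)) :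
    toInflation N M (0 : (geometricFixedPoints N).obj M ⟶ K) = 0 := by
  simpa using toInflation_add N M (0 : (geometricFixedPoints N).obj M ⟶ K) 0

omit [Finite G] in
/-- Inflation commutes with shifts by `G/N`-sets. -/
noncomputable def inflationShiftIso (K : MackeyFunctor (G ⧸ N)) (X : BurnsideCat (G ⧸ N)) :
    (inflation N).obj (K.shift.obj X) ≅
      ((inflation N).obj K).shift.obj ((BurnsideCat.res (QuotientGroup.mk' N)).obj X) :=
  (additiveFunctor _ _).isoMk (NatIso.ofComponents
    (fun Y => K.obj.mapIso ((prodFixedPointsIso N).symm.app (X, Y)))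
    fun {Y Y'} g => by
      have h := (prodFixedPointsIso N).inv.naturality
        (show ((X, Y) : BurnsideCat (G ⧸ N) × BurnsideCat G) ⟶ (X, Y') from (𝟙 X, g))
      have h' := congrArg K.obj.map h
      refine (K.obj.map_comp _ _).symm.trans (Eq.trans ?_ (K.obj.map_comp _ _))
      refine h'.trans (congrArg (fun t => K.obj.map
        ((prodFixedPointsIso N).inv.app (X, Y) ≫ (fixedPoints N).map t)) ?_)
      exact congrArg (fun t : (BurnsideCat.res (QuotientGroup.mk' N)).obj X ⟶ _ =>
        (BurnsideCat.prodFunctor G).map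
          (show ((BurnsideCat.res (QuotientGroup.mk' N)).obj X, Y) ⟶ (_, Y') from (t, g)))
        ((BurnsideCat.res (QuotientGroup.mk' N)).map_id X))

omit [Finite G] in
theorem inflationShiftIso_naturality (K : MackeyFunctor (G ⧸ N)) {X X' : BurnsideCat (G ⧸ N)}
    (f : X ⟶ X') :
    (inflation N).map (K.shift.map f) ≫ (inflationShiftIso N K X').hom =
      (inflationShiftIso N K X).hom ≫
        ((inflation N).obj K).shift.map ((BurnsideCat.res (QuotientGroup.mk' N)).map f) := by
  refine ObjectProperty.hom_ext _ (NatTrans.ext (funext fun Y => ?_))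
  have h := (prodFixedPointsIso N).inv.naturality
    (show ((X, Y) : BurnsideCat (G ⧸ N) × BurnsideCat G) ⟶ (X', Y) from (f, 𝟙 Y))
  have h' := congrArg K.obj.map h
  refine (K.obj.map_comp _ _).symm.trans (Eq.trans ?_ (K.obj.map_comp _ _))
  refine Eq.trans ?_ h'
  refine congrArg (fun t => K.obj.map (t ≫ (prodFixedPointsIso N).inv.app (X', Y))) ?_
  exact congrArg (fun t : (fixedPoints N).obj Y ⟶ _ =>
    (BurnsideCat.prodFunctor (G ⧸ N)).map
      (show (X, (fixedPoints N).obj Y) ⟶ (X', _) from (f, t))) ((fixedPoints N).map_id Y).symm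

omit [Finite G] in
theorem inflationShiftIso_naturality_left {K K' : MackeyFunctor (G ⧸ N)} (h : K ⟶ K')
    (X : BurnsideCat (G ⧸ N)) :
    (inflation N).map ((shiftMap h).app X) ≫ (inflationShiftIso N K' X).hom =
      (inflationShiftIso N K X).hom ≫ (shiftMap ((inflation N).map h)).app _ := by
  refine hom_ext_apply fun Y m => ?_
  exact (hom_naturality_apply h ((prodFixedPointsIso N).inv.app (X, Y)) m).symm

/-- The comparison of internal homs which is right adjoint to the projection formula for geometric
fixed points. -/
noncomputable def internalHomComparison : internalHom ((geometricFixedPoints N).obj M) ⟶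
    inflation N ⋙ internalHom M ⋙ qLowerStar N where
  app K := ObjectProperty.homMk
    { app := fun X => AddCommGrpCat.ofHom
        { toFun := fun f => toInflation N M (show _ ⟶ K.shift.obj X from f) ≫
            (inflationShiftIso N K X).hom
          map_zero' := by
            refine (congrArg (· ≫ (inflationShiftIso N K X).hom) (toInflation_zero N M _)).trans ?_
            exact zero_comp
          map_add' := fun f g => by
            refine (congrArg (· ≫ (inflationShiftIso N K X).hom) (toInflation_add N M
              (show _ ⟶ K.shift.obj X from f) g)).trans ?_
            exact Preadditive.add_comp _ _ _ _ _ _ }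
      naturality := fun X X' g => by
        ext f
        let f' : (geometricFixedPoints N).obj M ⟶ K.shift.obj X := f
        change toInflation N M (f' ≫ K.shift.map g) ≫ (inflationShiftIso N K X').hom =
          (toInflation N M f' ≫ (inflationShiftIso N K X).hom) ≫
            ((inflation N).obj K).shift.map ((BurnsideCat.res (QuotientGroup.mk' N)).map g)
        rw [toInflation_comp, Category.assoc, inflationShiftIso_naturality, Category.assoc] }
  naturality K K' h := by
    refine ObjectProperty.hom_ext _ (NatTrans.ext (funext fun X => ?_))
    ext f
    let f' : (geometricFixedPoints N).obj M ⟶ K.shift.obj X := f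
    change toInflation N M (f' ≫ (shiftMap h).app X) ≫ (inflationShiftIso N K' X).hom =
      (toInflation N M f' ≫ (inflationShiftIso N K X).hom) ≫
        (shiftMap ((inflation N).map h)).app _
    rw [toInflation_comp, Category.assoc, inflationShiftIso_naturality_left, Category.assoc]

instance : IsIso (internalHomComparison N M) := by
  rw [NatTrans.isIso_iff_isIso_app]
  intro K
  rw [← ObjectProperty.isIso_hom_iff, NatTrans.isIso_iff_isIso_app]
  intro X
  rw [ConcreteCategory.isIso_iff_bijective]
  have h : Function.Bijective fun f : M ⟶ (inflation N).obj (K.shift.obj X) =>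
      f ≫ (inflationShiftIso N K X).hom :=
    ⟨fun f g h => (cancel_mono _).1 h, fun g => ⟨g ≫ (inflationShiftIso N K X).inv, by simp⟩⟩
  -- At `K` and `X` the comparison is the adjunction bijection for `K(X × -)` followed by an
  -- isomorphism of targets.
  exact h.comp (toInflation_bijective N M (K.shift.obj X))

/-- The comparison of internal homs is an isomorphism. -/
noncomputable def internalHomIso : internalHom ((geometricFixedPoints N).obj M) ≅
    inflation N ⋙ internalHom M ⋙ qLowerStar N :=
  asIso (internalHomComparison N M)

/-- The functor `- ⊠ M` on geometric Mackey functors. -/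
noncomputable def geometricBox : (geometric N).FullSubcategory ⥤ (geometric N).FullSubcategory :=
  (geometric N).lift ((geometric N).ι ⋙ Prod.sectL (MackeyFunctor G) M ⋙ box G)
    fun P => geometric_box P.property M

/-- The internal hom on geometric Mackey functors. -/
noncomputable def geometricInternalHom :
    (geometric N).FullSubcategory ⥤ (geometric N).FullSubcategory :=
  (geometric N).lift ((geometric N).ι ⋙ internalHom M) fun W => geometric_internalHom M W.property

/-- The adjunction between the box product and the internal hom, on geometric Mackey functors. -/
noncomputable def geometricBoxAdjunction : geometricBox N M ⊣ geometricInternalHom N M :=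
  (boxAdjunction M).restrictFullyFaithful (geometric N).fullyFaithfulι (geometric N).fullyFaithfulι
    (Iso.refl _) (Iso.refl _)

/-- The projection formula `L ⊠ Φ^N M ≅ q_* (L' ⊠ M)`, where `L'` is the inflation of `L`. -/
noncomputable def projectionFormula :
    Prod.sectL _ ((geometricFixedPoints N).obj M) ⋙ box (G ⧸ N) ≅
      inflation N ⋙ (Prod.sectL (MackeyFunctor G) M ⋙ box G) ⋙ qLowerStar N :=
  -- The second left adjoint is inflation to geometric functors, `- ⊠ M` there, then `q_*`. The
  -- equivalence is used in both directions, so its right adjoint is the target of `internalHomIso`.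
  ((conjugateIsoEquiv (boxAdjunction ((geometricFixedPoints N).obj M))
    ((geometricEquivalence N).symm.toAdjunction.comp
      ((geometricBoxAdjunction N M).comp (geometricEquivalence N).toAdjunction))).symm
    (internalHomIso N M)).symm

theorem isFlat_geometricFixedPoints (hM : M.IsFlat) : ((geometricFixedPoints N).obj M).IsFlat :=
  (exactFunctor _ _).prop_of_iso (projectionFormula N M).symm
    (exactFunctor_comp (precomp_exact (fixedPoints N))
      (exactFunctor_comp hM (precomp_exact (BurnsideCat.res (QuotientGroup.mk' N)))))

end MackeyFunctor
end EquivariantAlgebra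

theorem mainTheorem8 (G : Type u) [Group G] [Finite G] (N : Subgroup G) [N.Normal]
    (M : EquivariantAlgebra.MackeyFunctor G) (hM : M.IsFlat) :
    ((EquivariantAlgebra.MackeyFunctor.geometricFixedPoints N).obj M).IsFlat :=
  EquivariantAlgebra.MackeyFunctor.isFlat_geometricFixedPoints N M hM
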